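/- **Setting.** Let $q=(q_1,\dots,q_l):\mathbb R^m\to\mathbb R^l$ be twice continuously differentiable, $\Gamma=\{y\mid q_i(y)\le 0,\ i=1,\dots,l\}$, $\bar y\in\Gamma$ and $\bar y^*\in\widehat N_\Gamma(\bar y)$. For a set $\Omega$, $T_\Omega(z)=\{u\mid\exists t_k\downarrow0,\,u_k\to u:\ z+t_ku_k\in\Omega\ \forall k\}$ is the contingent cone, and $\widehat N_\Omega(z)=\{z^*\mid\limsup_{z'\to z,\,z'\in\Omega}\langle z^*,z'-z\rangle/\|z'-z\|\le0\}$ is the regular normal cone if $z\in\Omega$, with $\widehat N_\Omega(z)=\emptyset$ if $z\notin\Omega$. For a convex set $C$ and $z\in C$, $N_C(z)$ is the normal cone of convex analysis. Put $M_q(y)=q(y)-\mathbb R^l_-$; it is metrically subregular at $(\bar y,0)$ if there are $\kappa>0$ and a neighbourhood $U$ of $\bar y$ with $\operatorname{dist}(y,M_q^{-1}(0))\le\kappa\operatorname{dist}(0,M_q(y))$ for all $y\in U$. For $v^*\in\mathbb R^m$ let $N^2_{\operatorname{gph}\widehat N_\Gamma}((\bar y,\bar y^*);(0,v^*))$ be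 the set of all $(w^*,w)$ for which there are $t_k\downarrow 0$, $v_k^*\to v^*$ and $(w_k^*,w_k)\to(w^*,w)$ with $(w_k^*,w_k)\in\widehat N_{\operatorname{gph}\widehat N_\Gamma}(\bar y,\bar y^*+t_kv_k^*)$ for all $k$. Let $\bar I=\{i\mid q_i(\bar y)=0\}$, $\bar K=T_\Gamma(\bar y)\cap(\bar y^*)^\perp$, $\mathcal N(\bar y)=\{v\mid\nabla q_i(\bar y)v=0,\ i\in\bar I\}$, and $\bar\Lambda=\{\lambda\in N_{\mathbb R^l_-}(q(\bar y))\mid\nabla q(\bar y)^T\lambda=\bar y^*\}$. Let $\bar\Lambda(v)$ be the set of maximizers of $v^T\nabla^2(\lambda^Tq)(\bar y)v$ over $\lambda\in\bar\Lambda$, and let $\bar\Lambda^{\mathcal E}(v)=\bar\Lambda(v)\cap\operatorname{co}\bar{\mathcal E}$, where $\bar{\mathcal E}$ is the set of extreme points of $\bar\Lambda$. If $v\ne0$, put $\tilde\Lambda^{\mathcal E}(v)=\bar\Lambda^{\mathcal E}(v)$; if $\bar K\neq\{0\}$, put $\tilde\Lambda^{\mathcal E}(0)=\operatorname{co}\bigcup_{0\ne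 u\in\bar K}\bar\Lambda^{\mathcal E}(u)$. Let $$\bar M(0,v^*)=\{(\lambda,\mu)\mid\lambda\in\bar\Lambda,\ \mu\in T_{N_{\mathbb R^l_-}(q(\bar y))}(\lambda),\ v^*=\nabla q(\bar y)^T\mu\},$$ and $I^+(\lambda,\mu)=\{i\mid\lambda_i>0\}\cup\{i\mid\lambda_i=0,\ \mu_i>0\}$. For $v\in\mathcal N(\bar y)$ let $\bar{\mathcal J}(v)$ be the collection of all index sets $\{i\in\bar I\mid\nabla q_i(\bar y)z+v^T\nabla^2q_i(\bar y)v=0\}$, where $z$ runs over all vectors with $\nabla q_i(\bar y)z+v^T\nabla^2q_i(\bar y)v\le0$ for all $i\in\bar I$. For $I^+\subset I\subset\bar I$ let $P_{I^+,I}=\{\mu\in\mathbb R^l\mid\mu_i=0\ (i\notin I),\ \mu_i\ge0\ (i\in I\setminus I^+)\}$, let $\bar K_{I^+,I}(v)$ be the set of all $w$ such that $\nabla q_i(\bar y)w=0$ $(i\in I^+)$, $\nabla q_i(\bar y)w\le0$ $(i\in I\setminus I^+)$, and for some $z\in\mathbb R^m$, $\nabla q_i(\bar y)z+v^T\nabla^2q_i(\bar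 y)w=0$ $(i\in I^+)$ and $\nabla q_i(\bar y)z+v^T\nabla^2q_i(\bar y)w\le0$ $(i\in I\setminus I^+)$, and let $$Q_0(v,\lambda,I^+,I)=\{(w^*,w)\mid w\in\bar K_{I^+,I}(v),\ w^*+\nabla^2(\lambda^Tq)(\bar y)w\in\nabla q(\bar y)^TP_{I^+,I}\}.$$ **Proposition.** Let $v^*\ne0$ be such that $(0,v^*)\in T_{\operatorname{gph}\widehat N_\Gamma}(\bar y,\bar y^*)$, and assume that $M_q$ is metrically subregular at $(\bar y,0)$. If $\bar K\ne\{0\}$, then $$N^2_{\operatorname{gph}\widehat N_\Gamma}((\bar y,\bar y^*);(0,v^*))\subset\bigcap_{\tilde v\in\mathcal N(\bar y)}\ \bigcup_{\substack{(\lambda,\mu)\in\bar M(0,v^*),\ \lambda\in\tilde\Lambda^{\mathcal E}(\tilde v)\\ J\in\bar{\mathcal J}(\tilde v)}}\ \bigcup_{I^+(\lambda,\mu)\subset I^+\subset I\subset J}Q_0(\tilde v,\lambda,I^+,I).$$ If $\bar K=\{0\}$, then $N^2_{\operatorname{gph}\widehat N_\Gamma}((\bar y,\bar y^*);(0,v^*))\subset\mathbb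 R^m\times\{0\}$. -/

import Mathlib

open Filter Topology

noncomputable section

namespace NormalConeMap

/-- `ℝⁿ` with the Euclidean norm. -/
abbrev Eu (n : ℕ) := EuclideanSpace ℝ (Fin n)

/-- `ℝᵐ × ℝᵐ` with the Euclidean norm and inner product. -/
abbrev Pair (m : ℕ) := WithLp 2 (Eu m × Eu m)

/-- The element `(a, b)` of `ℝᵐ × ℝᵐ`. -/
def pair {m : ℕ} (a b : Eu m) : Pair m := WithLp.toLp 2 (a, b)

section General

variable {E : Type*} [NormedAddCommGroup E] [InnerProductSpace ℝ E]

/-- The Bouligand (contingent) tangent cone `T_Ω(z)`. -/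
def tangentCone (Ω : Set E) (z : E) : Set E :=
  {u | ∃ (t : ℕ → ℝ) (us : ℕ → E), (∀ k, 0 < t k) ∧ Tendsto t atTop (𝓝 0) ∧
    Tendsto us atTop (𝓝 u) ∧ ∀ k, z + t k • us k ∈ Ω}

/-- The regular (Fréchet) normal cone `N̂_Ω(z)`; it is empty when `z ∉ Ω`. The condition
`limsup ⟨v, z' - z⟩ / ‖z' - z‖ ≤ 0` as `z' → z` in `Ω` is written without division. -/
def regNormalCone (Ω : Set E) (z : E) : Set E :=
  {v | z ∈ Ω ∧ ∀ ε : ℝ, 0 < ε → ∀ᶠ z' in 𝓝[Ω] z, inner ℝ v (z' - z) ≤ ε * ‖z' - z‖}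

/-- The normal cone of convex analysis to a convex set `C`; it is empty when `z ∉ C`. -/
def convNormalCone (C : Set E) (z : E) : Set E :=
  {v | z ∈ C ∧ ∀ x ∈ C, inner ℝ v (x - z) ≤ 0}

/-- The Hessian of `f` at `x`, as a linear operator. -/
def hess [CompleteSpace E] (f : E → ℝ) (x : E) : E →L[ℝ] E := fderiv ℝ (gradient f) x

end General

/-- Metric subregularity of the multifunction `Ψ` at `(u, v)`. Distances are extended-valued, so
that the distance to the empty set is `∞`. -/
def MetricallySubregularAt {X Y : Type*} [PseudoEMetricSpace X] [PseudoEMetricSpace Y]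
    (Ψ : X → Set Y) (u : X) (v : Y) : Prop :=
  v ∈ Ψ u ∧ ∃ κ : ℝ, 0 < κ ∧ ∃ U ∈ 𝓝 u, ∀ x ∈ U,
    Metric.infEDist x {x' | v ∈ Ψ x'} ≤ ENNReal.ofReal κ * Metric.infEDist v (Ψ x)

/-- The graph of a multifunction from `ℝᵐ` to `ℝᵐ`. -/
def gph {m : ℕ} (Ψ : Eu m → Set (Eu m)) : Set (Pair m) := {p | p.snd ∈ Ψ p.fst}

/-- The part `N²_Ω((ybar, ystar); (0, vstar))` of the directional limiting normal cone to
`Ω ⊆ ℝᵐ × ℝᵐ`: limits of regular normals taken along `(ybar, ystar + t_k v_k)`. -/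
def normalConeTwo {m : ℕ} (Ω : Set (Pair m)) (ybar ystar vstar : Eu m) : Set (Pair m) :=
  {p | ∃ (t : ℕ → ℝ) (vs : ℕ → Eu m) (ws : ℕ → Pair m),
    (∀ k, 0 < t k) ∧ Tendsto t atTop (𝓝 0) ∧ Tendsto vs atTop (𝓝 vstar) ∧
    Tendsto ws atTop (𝓝 p) ∧
    ∀ k, ws k ∈ regNormalCone Ω (pair ybar (ystar + t k • vs k))}

section Constraints

variable {m l : ℕ}

/-- The nonpositive orthant `ℝˡ₋`. -/
def nonposOrthant (l : ℕ) : Set (Eu l) := {x | ∀ i, x i ≤ 0}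

/-- `Γ = {y | q_i(y) ≤ 0 for all i}`. -/
def feasibleSet (q : Eu m → Eu l) : Set (Eu m) := {y | ∀ i, q y i ≤ 0}

/-- The perturbation mapping `M_q(y) = q(y) - ℝˡ₋`. -/
def perturbMap (q : Eu m → Eu l) (y : Eu m) : Set (Eu l) :=
  (fun p => q y - p) '' nonposOrthant l

/-- The graph of `y ↦ N̂_Γ(y)`. -/
def gphNormal (q : Eu m → Eu l) : Set (Pair m) := gph (regNormalCone (feasibleSet q))

/-- `∇q_i(y) v`. -/
def dq (q : Eu m → Eu l) (y : Eu m) (i : Fin l) (v : Eu m) : ℝ := fderiv ℝ q y v i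

/-- `∇q(y)ᵀ μ`. -/
def dqT (q : Eu m → Eu l) (y : Eu m) (μ : Eu l) : Eu m :=
  ContinuousLinearMap.adjoint (fderiv ℝ q y) μ

/-- `vᵀ ∇²q_i(y) w`. -/
def d2q (q : Eu m → Eu l) (y : Eu m) (i : Fin l) (v w : Eu m) : ℝ :=
  inner ℝ v (hess (fun x => q x i) y w)

/-- The matrix `∇²(λᵀq)(y)`. -/
def hessLag (q : Eu m → Eu l) (lam : Eu l) (y : Eu m) : Eu m →L[ℝ] Eu m :=
  hess (fun x => ∑ i, lam i * q x i) y

/-- The set of active indices `I(y)`. -/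
def active (q : Eu m → Eu l) (y : Eu m) : Set (Fin l) := {i | q y i = 0}

/-- `I(y; v)`. -/
def activeDir (q : Eu m → Eu l) (y v : Eu m) : Set (Fin l) :=
  {i | i ∈ active q y ∧ dq q y i v = 0}

/-- The null space `𝒩(y)` of the gradients of the active constraints. -/
def nullSpace (q : Eu m → Eu l) (y : Eu m) : Set (Eu m) :=
  {v | ∀ i ∈ active q y, dq q y i v = 0}

/-- The critical cone `K(y, ystar) = T_Γ(y) ∩ ystar^⊥`. -/
def criticalCone (q : Eu m → Eu l) (y ystar : Eu m) : Set (Eu m) :=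
  {v | v ∈ tangentCone (feasibleSet q) y ∧ inner ℝ ystar v = 0}

/-- The multiplier set `Λ(y, ystar)`. -/
def multipliers (q : Eu m → Eu l) (y ystar : Eu m) : Set (Eu l) :=
  {lam | lam ∈ convNormalCone (nonposOrthant l) (q y) ∧ dqT q y lam = ystar}

/-- The directional multiplier set `Λ(y, ystar; v)`: the maximizers of `vᵀ∇²(λᵀq)(y)v` over
`Λ(y, ystar)`. -/
def dirMultipliers (q : Eu m → Eu l) (y ystar v : Eu m) : Set (Eu l) :=
  {lam | lam ∈ multipliers q y ystar ∧ ∀ lam' ∈ multipliers q y ystar,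
    inner ℝ v (hessLag q lam' y v) ≤ inner ℝ v (hessLag q lam y v)}

/-- `Λ^ℰ(y, ystar; v) = Λ(y, ystar; v) ∩ co ℰ(y, ystar)`, where `ℰ(y, ystar)` is the set of
extreme points of `Λ(y, ystar)`. -/
def extDirMultipliers (q : Eu m → Eu l) (y ystar v : Eu m) : Set (Eu l) :=
  dirMultipliers q y ystar v ∩ convexHull ℝ ((multipliers q y ystar).extremePoints ℝ)

open scoped Classical in
/-- `Λ̃^ℰ(y, ystar; v)`: equal to `Λ^ℰ(y, ystar; v)` for `v ≠ 0`, and to the convex hull of the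
union of all `Λ^ℰ(y, ystar; u)`, `0 ≠ u ∈ K(y, ystar)`, for `v = 0` (only used when
`K(y, ystar) ≠ {0}`). -/
def extDirMultipliersTilde (q : Eu m → Eu l) (y ystar v : Eu m) : Set (Eu l) :=
  if v = 0 then
    convexHull ℝ (⋃ u ∈ {u | u ∈ criticalCone q y ystar ∧ u ≠ 0}, extDirMultipliers q y ystar u)
  else extDirMultipliers q y ystar v

/-- `M(v, vstar)`: the pairs `(λ, μ)` with `λ ∈ Λ(y, ystar; v)`, `μ` tangent to `N_{ℝˡ₋}(q(y))` at
`λ` and `vstar = ∇²(λᵀq)(y)v + ∇q(y)ᵀμ`. -/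
def multiplierPairs (q : Eu m → Eu l) (y ystar v vstar : Eu m) : Set (Eu l × Eu l) :=
  {p | p.1 ∈ dirMultipliers q y ystar v ∧
    p.2 ∈ tangentCone (convNormalCone (nonposOrthant l) (q y)) p.1 ∧
    vstar = hessLag q p.1 y v + dqT q y p.2}

/-- `I⁺(λ) = {i | λ_i > 0}`. -/
def posIdx (lam : Eu l) : Set (Fin l) := {i | 0 < lam i}

/-- `I⁺(λ, μ) = I⁺(λ) ∪ {i | λ_i = 0, μ_i > 0}`. -/
def posIdxPair (lam μ : Eu l) : Set (Fin l) := posIdx lam ∪ {i | lam i = 0 ∧ 0 < μ i}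

/-- The feasible region `Ξ(v)` of the dual linear program. -/
def dualFeasible (q : Eu m → Eu l) (y v : Eu m) : Set (Eu m) :=
  {z | ∀ i ∈ active q y, dq q y i z + d2q q y i v v ≤ 0}

/-- `J(z) = {i ∈ I(y; v) | ∇q_i(y)z + vᵀ∇²q_i(y)v = 0}`. -/
def dualActive (q : Eu m → Eu l) (y v z : Eu m) : Set (Fin l) :=
  {i | i ∈ activeDir q y v ∧ dq q y i z + d2q q y i v v = 0}

/-- The collection `𝒥(v) = {J(z) | z ∈ Ξ(v)}`. -/
def dualActiveSets (q : Eu m → Eu l) (y v : Eu m) : Set (Set (Fin l)) :=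
  dualActive q y v '' dualFeasible q y v

/-- `P_{I⁺,I}`. -/
def PCone (Ip I : Set (Fin l)) : Set (Eu l) :=
  {μ | (∀ i, i ∉ I → μ i = 0) ∧ ∀ i ∈ I \ Ip, 0 ≤ μ i}

/-- `K_{I⁺,I}(y)`. -/
def KCone (q : Eu m → Eu l) (y : Eu m) (Ip I : Set (Fin l)) : Set (Eu m) :=
  {w | (∀ i ∈ Ip, dq q y i w = 0) ∧ ∀ i ∈ I \ Ip, dq q y i w ≤ 0}

/-- `K_{I⁺,I}(v)` at the point `y`: the `w ∈ K_{I⁺,I}(y)` for which some `z` satisfies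
`∇q_i(y)z + vᵀ∇²q_i(y)w = 0` on `I⁺` and `≤ 0` on `I \ I⁺`. -/
def KConeDir (q : Eu m → Eu l) (y : Eu m) (Ip I : Set (Fin l)) (v : Eu m) : Set (Eu m) :=
  {w | w ∈ KCone q y Ip I ∧ ∃ z : Eu m, (∀ i ∈ Ip, dq q y i z + d2q q y i v w = 0) ∧
    ∀ i ∈ I \ Ip, dq q y i z + d2q q y i v w ≤ 0}

/-- `Q₀(v, λ, I⁺, I)` at the point `y`: the pairs `(wstar, w)` with `w ∈ K_{I⁺,I}(v)` and
`wstar + ∇²(λᵀq)(y)w ∈ ∇q(y)ᵀ P_{I⁺,I}`. -/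
def QZero (q : Eu m → Eu l) (y v : Eu m) (lam : Eu l) (Ip I : Set (Fin l)) : Set (Pair m) :=
  {p | p.snd ∈ KConeDir q y Ip I v ∧ p.fst + hessLag q lam y p.snd ∈ dqT q y '' PCone Ip I}

end Constraints

end NormalConeMap

end

open NormalConeMap

/-! Write A i for the gradient of q_i at `ybar` and B i for its Hessian form. A regular normal (w*,
w) to the graph at (`ybar`, y*) is polar to the tangent directions of the graph. Varying y* inside
the normal cone at `ybar` puts w in the critical cone of y*
(`snd_mem_critCone_of_mem_regNormalCone_gphNormal`). If v is critical and the multiplier λ maximizes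
∑ λ_i B i v v, then (v, ∇²(λᵀq)v) is also a tangent direction (`eventually_exists_gphNormal`),
whence ⟨w*, v⟩ + ∑ λ_i B i v w ≤ 0 (`polar_of_mem_regNormalCone_gphNormal`). Metric subregularity
enters through the feasible curves behind these facts. The rest is finite linear programming.

Fix a null vector v. Both v and -v are critical, so the polar inequality is an equality at v.
Applied at v + s u, with u critical, it involves a maximizer with linearly independent active
gradients. There are finitely many such multipliers, so one of them, e, serves for arbitrarily small
s. It is then maximal at v too, and subtracting the equality leaves the inequality at u with
multiplier e (`exists_extremal_multiplier`). The choice of e depends on u, but a minimax argument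
(`exists_convex_comb`) replaces all of them by one convex combination λ, for which w* + ∇²(λᵀq)w is
polar to a polyhedral cone. Linear programming duality supplies the index sets and the auxiliary
vectors z; the outcome is `PolarData` (`exists_polarData`).

These data survive the limit along (`ybar`, `ystar` + t_k v_k). Index sets take finitely many
values, weights are bounded, and a multiplier with independent support is determined linearly by the
functional it represents. The remaining conditions are solvability of linear systems with fixed
index sets, which is closed under limits (`exists_polarData_of_tendsto`). A common index set Ip
along the subsequence also represents the difference quotients, and Farkas' lemma gives μ with ∇qᵀμ
= `vstar` supported in Ip, hence I⁺(λ, μ) ⊆ Ip (`exists_tangent_multiplier`).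

The null vector 0 needs a nonzero critical direction at which each extremal multiplier is maximal;
normalizing these directions keeps them nonzero in the limit. If the approximating critical cones
are eventually trivial, then w = 0 and the data are built directly from a nonzero critical direction
of `ystar` (`exists_polarData_of_critCone_trivial`). If the critical cone of `ystar` is trivial, it
contains the limit w, so w = 0. -/

namespace NormalConeMap

/-! ### Farkas' lemma and linear programming duality. -/

section LinearInequalities

variable {ι V : Type*} [Fintype ι] [AddCommGroup V] [Module ℝ V]

/-- Farkas' lemma for a finite subfamily of linear functionals. -/
theorem farkas_finset {ι V : Type*} [AddCommGroup V] [Module ℝ V] (s : Finset ι) :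
    ∀ (A : ι → V →ₗ[ℝ] ℝ) (b : V →ₗ[ℝ] ℝ),
      (∀ x, (∀ i ∈ s, A i x ≤ 0) → b x ≤ 0) →
        ∃ μ : ι → ℝ, (∀ i, 0 ≤ μ i) ∧ ∀ x, ∑ i ∈ s, μ i * A i x = b x := by
  classical
  induction s using Finset.induction_on with
  | empty =>
    intro A b h
    refine ⟨0, by simp, fun x => ?_⟩
    have h1 := h x (by simp)
    have h2 := h (-x) (by simp)
    rw [map_neg] at h2
    simp only [Finset.sum_empty]
    linarith
  | insert k s hk ih =>
    intro A b h
    by_cases hs : ∀ x, (∀ i ∈ s, A i x ≤ 0) → b x ≤ 0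
    · obtain ⟨μ, hμ, hb⟩ := ih A b hs
      refine ⟨Function.update μ k 0, fun i => ?_, fun x => ?_⟩
      · by_cases hi : i = k
        · subst hi; simp
        · simp [hi, hμ i]
      · rw [Finset.sum_insert hk, ← hb x]
        simp only [Function.update_self, zero_mul, zero_add]
        refine Finset.sum_congr rfl fun i hi => ?_
        rw [Function.update_of_ne (ne_of_mem_of_not_mem hi hk)]
    · push Not at hs
      -- Dropping constraint k admits a violating point. Scaled so that A k equals 1, it serves to
      -- project along itself onto the kernel of A k, where the induction hypothesis applies.
      obtain ⟨x1, hx1, hbx1⟩ := hs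
      have hk1 : 0 < A k x1 := by
        by_contra hcon
        push Not at hcon
        have := h x1 (by
          intro i hi
          rcases Finset.mem_insert.1 hi with rfl | hi
          · exact hcon
          · exact hx1 i hi)
        linarith
      set x0 := (A k x1)⁻¹ • x1 with hx0
      have hkx0 : A k x0 = 1 := by
        rw [hx0, map_smul, smul_eq_mul, inv_mul_cancel₀ hk1.ne']
      have hsx0 : ∀ i ∈ s, A i x0 ≤ 0 := by
        intro i hi
        rw [hx0, map_smul, smul_eq_mul]
        exact mul_nonpos_of_nonneg_of_nonpos (inv_pos.2 hk1).le (hx1 i hi)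
      have hbx0 : 0 < b x0 := by
        rw [hx0, map_smul, smul_eq_mul]
        exact mul_pos (inv_pos.2 hk1) hbx1
      obtain ⟨μ, hμ, hb⟩ := ih (fun i => A i - A i x0 • A k) (b - b x0 • A k) (by
        intro x hx
        have h1 := h (x - A k x • x0) (by
          intro i hi
          rcases Finset.mem_insert.1 hi with rfl | hi
          · simp [hkx0]
          · have := hx i hi
            simp only [LinearMap.sub_apply, LinearMap.smul_apply, smul_eq_mul] at this
            simp only [map_sub, map_smul, smul_eq_mul]
            linarith)
        simp only [map_sub, map_smul, smul_eq_mul] at h1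
        simp only [LinearMap.sub_apply, LinearMap.smul_apply, smul_eq_mul]
        linarith)
      have hneg : ∑ i ∈ s, μ i * A i x0 ≤ 0 :=
        Finset.sum_nonpos fun i hi => mul_nonpos_of_nonneg_of_nonpos (hμ i) (hsx0 i hi)
      -- The coefficient of A k is forced by evaluating at `x0`; it is nonnegative because b x0 > 0
      -- and the subtracted sum is nonpositive.
      refine ⟨Function.update μ k (b x0 - ∑ i ∈ s, μ i * A i x0), fun i => ?_, fun x => ?_⟩
      · by_cases hi : i = k
        · subst hi; simp only [Function.update_self]; linarith
        · simp [hi, hμ i]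
      · rw [Finset.sum_insert hk, Function.update_self]
        have h2 : ∑ i ∈ s, Function.update μ k (b x0 - ∑ i ∈ s, μ i * A i x0) i * A i x =
            ∑ i ∈ s, μ i * A i x := by
          refine Finset.sum_congr rfl fun i hi => ?_
          rw [Function.update_of_ne (ne_of_mem_of_not_mem hi hk)]
        have h3 := hb x
        simp only [LinearMap.sub_apply, LinearMap.smul_apply, smul_eq_mul, mul_sub,
          Finset.sum_sub_distrib] at h3
        have h4 : ∑ i ∈ s, μ i * (A i x0 * A k x) = (∑ i ∈ s, μ i * A i x0) * A k x := by
          rw [Finset.sum_mul]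
          exact Finset.sum_congr rfl fun i _ => by ring
        rw [h2]
        rw [h4] at h3
        linarith

/-- Farkas' lemma. -/
theorem farkas (A : ι → V →ₗ[ℝ] ℝ) (b : V →ₗ[ℝ] ℝ)
    (h : ∀ x, (∀ i, A i x ≤ 0) → b x ≤ 0) :
    ∃ μ : ι → ℝ, (∀ i, 0 ≤ μ i) ∧ ∀ x, ∑ i, μ i * A i x = b x :=
  farkas_finset Finset.univ A b fun x hx => h x fun i => hx i (Finset.mem_univ i)

/-- Multipliers vanishing outside `I` and nonnegative on `I \ Ip`. -/
def MixedSign (Ip I : Set ι) (μ : ι → ℝ) : Prop :=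
  (∀ i, i ∉ I → μ i = 0) ∧ ∀ i ∈ I \ Ip, 0 ≤ μ i

/-- `A i x + b i` vanishes on `Ip` and is nonpositive on `I \ Ip`. -/
def SolvesSystem (A : ι → V →ₗ[ℝ] ℝ) (b : ι → ℝ) (Ip I : Set ι) (x : V) : Prop :=
  (∀ i ∈ Ip, A i x + b i = 0) ∧ ∀ i ∈ I \ Ip, A i x + b i ≤ 0

omit [Fintype ι] in
theorem SolvesSystem.le {A : ι → V →ₗ[ℝ] ℝ} {b : ι → ℝ} {Ip I : Set ι} {x : V}
    (h : SolvesSystem A b Ip I x) {i : ι} (hi : i ∈ I) : A i x + b i ≤ 0 := by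
  by_cases hip : i ∈ Ip
  · exact (h.1 i hip).le
  · exact h.2 i ⟨hi, hip⟩

theorem MixedSign.sum_mul_nonpos {Ip I : Set ι} {μ : ι → ℝ} (hμ : MixedSign Ip I μ)
    {A : ι → V →ₗ[ℝ] ℝ} {b : ι → ℝ} {x : V} (hx : SolvesSystem A b Ip I x) :
    ∑ i, μ i * (A i x + b i) ≤ 0 := by
  refine Finset.sum_nonpos fun i _ => ?_
  by_cases hi : i ∈ I
  · by_cases hip : i ∈ Ip
    · rw [hx.1 i hip, mul_zero]
    · exact mul_nonpos_of_nonneg_of_nonpos (hμ.2 i ⟨hi, hip⟩) (hx.2 i ⟨hi, hip⟩)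
  · rw [hμ.1 i hi, zero_mul]

/-- Farkas' lemma for a system of equations and inequalities. -/
theorem farkas_mixed (A : ι → V →ₗ[ℝ] ℝ) (b : V →ₗ[ℝ] ℝ) {Ip I : Set ι} (hI : Ip ⊆ I)
    (h : ∀ x, SolvesSystem A 0 Ip I x → b x ≤ 0) :
    ∃ μ : ι → ℝ, MixedSign Ip I μ ∧ ∀ x, ∑ i, μ i * A i x = b x := by
  classical
  -- Each equation is split into two opposite inequalities, and indices outside the constraint sets
  -- carry the zero functional.
  obtain ⟨ν, hν, hb⟩ := farkas
    (Sum.elim (fun i => if i ∈ I then A i else 0) (fun i => if i ∈ Ip then -A i else 0)) b (by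
      intro x hx
      refine h x ⟨fun i hi => ?_, fun i hi => ?_⟩
      · have h1 := hx (Sum.inl i)
        have h2 := hx (Sum.inr i)
        simp only [Sum.elim_inl, Sum.elim_inr, if_pos (hI hi), if_pos hi,
          LinearMap.neg_apply] at h1 h2
        simp only [Pi.zero_apply]
        linarith
      · have h1 := hx (Sum.inl i)
        simpa [if_pos hi.1] using h1)
  refine ⟨fun i => (if i ∈ I then ν (Sum.inl i) else 0) - (if i ∈ Ip then ν (Sum.inr i) else 0),
    ⟨fun i hi => ?_, fun i hi => ?_⟩, fun x => ?_⟩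
  · have : i ∉ Ip := fun h' => hi (hI h')
    simp [hi, this]
  · simp [hi.1, hi.2, hν]
  · rw [← hb x, Fintype.sum_sum_type, ← Finset.sum_add_distrib]
    refine Finset.sum_congr rfl fun i _ => ?_
    simp only [Sum.elim_inl, Sum.elim_inr]
    split_ifs <;> simp
    ring

/-- The functional `(x, t) ↦ f x + c t`. -/
def homogenize (f : V →ₗ[ℝ] ℝ) (c : ℝ) : V × ℝ →ₗ[ℝ] ℝ :=
  f.comp (LinearMap.fst ℝ V ℝ) + c • LinearMap.snd ℝ V ℝ

omit [Fintype ι] in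
@[simp] theorem homogenize_apply (f : V →ₗ[ℝ] ℝ) (c : ℝ) (p : V × ℝ) :
    homogenize f c p = f p.1 + c * p.2 := rfl

/-- Theorem of the alternative for an inhomogeneous system of equations and inequalities. -/
theorem system_alternative (A : ι → V →ₗ[ℝ] ℝ) (b : ι → ℝ) {Ip I : Set ι} (hI : Ip ⊆ I) :
    (∃ z, SolvesSystem A b Ip I z) ∨
      ∃ δ : ι → ℝ, MixedSign Ip I δ ∧ (∀ x, ∑ i, δ i * A i x = 0) ∧ 0 < ∑ i, δ i * b i := by
  by_cases hz : ∃ z, SolvesSystem A b Ip I z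
  · exact Or.inl hz
  right
  -- A solution (x, t) of the homogenized system with t > 0 would rescale to a solution of the
  -- original one. So insolubility makes t ≤ 0 a consequence of the system.
  obtain ⟨δ, hδ, hsum⟩ := farkas_mixed (fun i => homogenize (A i) (b i))
    (homogenize (0 : V →ₗ[ℝ] ℝ) 1) hI (by
      rintro ⟨x, t⟩ ⟨h1, h2⟩
      by_contra hcon
      simp only [homogenize_apply, LinearMap.zero_apply, zero_add, one_mul, not_le,
        Pi.zero_apply, add_zero] at h1 h2 hcon
      have key : ∀ i, A i (t⁻¹ • x) + b i = t⁻¹ * (A i x + b i * t) := by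
        intro i
        rw [map_smul, smul_eq_mul]
        field_simp
      refine hz ⟨t⁻¹ • x, fun i hi => ?_, fun i hi => ?_⟩
      · rw [key, h1 i hi, mul_zero]
      · rw [key]
        exact mul_nonpos_of_nonneg_of_nonpos (inv_pos.2 hcon).le (h2 i hi))
  refine ⟨δ, hδ, fun x => ?_, ?_⟩
  · simpa using hsum (x, 0)
  · have := hsum (0, 1)
    simp only [homogenize_apply, map_zero, zero_add, mul_one] at this
    rw [this]; exact one_pos

/-- A multiplier which is optimal for a linear program admits a complementary dual solution. -/
theorem exists_complementary (A : ι → V →ₗ[ℝ] ℝ) (b : ι → ℝ) {Ip I : Set ι} (hI : Ip ⊆ I)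
    {μ : ι → ℝ} (hμ : MixedSign Ip I μ)
    (hmax : ∀ μ', MixedSign Ip I μ' → (∀ x, ∑ i, μ' i * A i x = ∑ i, μ i * A i x) →
      ∑ i, μ' i * b i ≤ ∑ i, μ i * b i) :
    ∃ z, SolvesSystem A b (Ip ∪ {i | μ i ≠ 0}) I z := by
  have hsub : Ip ∪ {i | μ i ≠ 0} ⊆ I := by
    rintro i (hi | hi)
    · exact hI hi
    · by_contra h; exact hi (hμ.1 i h)
  rcases system_alternative A b hsub with h | ⟨δ, hδ, hA, hb⟩
  · exact h
  exfalso
  -- A certificate δ of insolubility would be an improving direction: it has free sign only on `Ip`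
  -- and where μ is nonzero, so μ + tδ stays admissible for small t.
  have hev : ∀ᶠ t : ℝ in 𝓝[>] 0, ∀ i, i ∈ I \ Ip → 0 ≤ μ i + t * δ i := by
    rw [eventually_all]
    intro i
    by_cases hi : i ∈ I \ Ip
    swap
    · exact Eventually.of_forall fun t h => absurd h hi
    by_cases h0 : μ i = 0
    · have hδi : 0 ≤ δ i := hδ.2 i ⟨hi.1, fun h => h.elim hi.2 (fun h => h h0)⟩
      filter_upwards [self_mem_nhdsWithin] with t ht _
      rw [h0, zero_add]
      exact mul_nonneg (le_of_lt ht) hδi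
    · have hpos : 0 < μ i := lt_of_le_of_ne (hμ.2 i hi) (Ne.symm h0)
      have hc : Tendsto (fun t : ℝ => μ i + t * δ i) (𝓝[>] 0) (𝓝 (μ i + 0 * δ i)) :=
        ((continuous_const.add (continuous_id.mul continuous_const)).tendsto 0).mono_left
          nhdsWithin_le_nhds
      rw [zero_mul, add_zero] at hc
      filter_upwards [hc.eventually (lt_mem_nhds hpos)] with t ht _
      exact ht.le
  obtain ⟨t, ht, ht0⟩ := (hev.and self_mem_nhdsWithin).exists
  have ht0 : 0 < t := ht0
  have h1 := hmax (fun i => μ i + t * δ i) ⟨fun i hi => by simp [hμ.1 i hi, hδ.1 i hi], ht⟩ (by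
    intro x
    have : ∑ i, (μ i + t * δ i) * A i x = ∑ i, μ i * A i x + t * ∑ i, δ i * A i x := by
      rw [Finset.mul_sum, ← Finset.sum_add_distrib]
      exact Finset.sum_congr rfl fun i _ => by ring
    rw [this, hA, mul_zero, add_zero])
  have h2 : ∑ i, (μ i + t * δ i) * b i = ∑ i, μ i * b i + t * ∑ i, δ i * b i := by
    rw [Finset.mul_sum, ← Finset.sum_add_distrib]
    exact Finset.sum_congr rfl fun i _ => by ring
  rw [h2] at h1
  have := mul_pos ht0 hb
  linarith

/-- Strong duality: a feasible linear program with a feasible dual has a complementary pair. -/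
theorem exists_complementary_pair (A : ι → V →ₗ[ℝ] ℝ) (b : ι → ℝ) {Ip I : Set ι} (hI : Ip ⊆ I)
    {μ₀ : ι → ℝ} (hμ₀ : MixedSign Ip I μ₀) (hz : ∃ z, SolvesSystem A b Ip I z) :
    ∃ z μ, SolvesSystem A b Ip I z ∧ MixedSign Ip I μ ∧
      (∀ x, ∑ i, μ i * A i x = ∑ i, μ₀ i * A i x) ∧ ∀ i, μ i ≠ 0 → A i z + b i = 0 := by
  obtain ⟨z₀, hz₀⟩ := hz
  set a : V →ₗ[ℝ] ℝ := ∑ i, μ₀ i • A i with ha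
  have ha' : ∀ x, a x = ∑ i, μ₀ i * A i x := by
    intro x; simp [ha, LinearMap.sum_apply]
  have weak : ∀ μ, MixedSign Ip I μ → (∀ x, ∑ i, μ i * A i x = a x) →
      ∀ z, SolvesSystem A b Ip I z → a z ≤ -∑ i, μ i * b i := by
    intro μ hμ hA z hz
    have := hμ.sum_mul_nonpos hz
    simp only [mul_add, Finset.sum_add_distrib] at this
    rw [hA] at this
    linarith
  set S : Set ℝ := a '' {z | SolvesSystem A b Ip I z} with hS
  have hne : S.Nonempty := ⟨_, z₀, hz₀, rfl⟩
  have hbdd : BddAbove S := by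
    refine ⟨-∑ i, μ₀ i * b i, ?_⟩
    rintro _ ⟨z, hz, rfl⟩
    exact weak μ₀ hμ₀ (fun x => (ha' x).symm) z hz
  set p := sSup S
  have hp : ∀ z, SolvesSystem A b Ip I z → a z ≤ p := fun z hz => le_csSup hbdd ⟨z, hz, rfl⟩
  -- An optimal multiplier comes from homogenizing the valid inequality a z ≤ p. The index `none`
  -- carries the constraint t ≥ 0; for t = 0 the given multiplier μ₀ bounds a on the recession cone.
  obtain ⟨ν, hν, hsum⟩ := farkas_mixed (ι := Option ι)
    (fun o => o.elim (homogenize (0 : V →ₗ[ℝ] ℝ) (-1)) fun i => homogenize (A i) (b i))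
    (homogenize a (-p)) (Ip := some '' Ip) (I := some '' I ∪ {none})
    ((Set.image_mono hI).trans Set.subset_union_left) (by
      rintro ⟨x, t⟩ ⟨h1, h2⟩
      have h1' : ∀ i ∈ Ip, A i x + b i * t = 0 := fun i hi => by
        simpa using h1 (some i) ⟨i, hi, rfl⟩
      have h2' : ∀ i ∈ I \ Ip, A i x + b i * t ≤ 0 := fun i hi => by
        simpa using h2 (some i) ⟨Or.inl ⟨i, hi.1, rfl⟩, by simpa using hi.2⟩
      have ht : 0 ≤ t := by
        simpa using h2 none ⟨Or.inr rfl, by simp⟩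
      simp only [homogenize_apply]
      rcases ht.eq_or_lt with ht | ht
      · subst ht
        have := hμ₀.sum_mul_nonpos (A := A) (b := 0) (x := x)
          ⟨by simpa using h1', by simpa using h2'⟩
        simp only [Pi.zero_apply, add_zero] at this
        rw [ha']; linarith
      · have key : ∀ i, A i (t⁻¹ • x) + b i = t⁻¹ * (A i x + b i * t) := by
          intro i
          rw [map_smul, smul_eq_mul]
          field_simp
        have := hp (t⁻¹ • x) ⟨fun i hi => by rw [key, h1' i hi, mul_zero], fun i hi => by
          rw [key]; exact mul_nonpos_of_nonneg_of_nonpos (inv_pos.2 ht).le (h2' i hi)⟩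
        rw [map_smul, smul_eq_mul] at this
        have h3 := mul_le_mul_of_nonneg_left this ht.le
        rw [← mul_assoc, mul_inv_cancel₀ ht.ne', one_mul] at h3
        linarith)
  set μ : ι → ℝ := fun i => ν (some i) with hμdef
  have hμ : MixedSign Ip I μ := by
    refine ⟨fun i hi => hν.1 _ (by simpa using hi), fun i hi => hν.2 _ ⟨?_, ?_⟩⟩
    · exact Or.inl ⟨i, hi.1, rfl⟩
    · simpa using hi.2
  have hμA : ∀ x, ∑ i, μ i * A i x = a x := by
    intro x
    have := hsum (x, 0)
    rw [Fintype.sum_option] at this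
    simpa using this
  have hμb : -p ≤ ∑ i, μ i * b i := by
    have := hsum (0, 1)
    rw [Fintype.sum_option] at this
    have h0 : 0 ≤ ν none := hν.2 _ ⟨Or.inr rfl, by simp⟩
    simp only [Option.elim, homogenize_apply, map_zero, zero_add, mul_one] at this
    change _ + ∑ i, μ i * b i = _ at this
    linarith
  obtain ⟨z, hz⟩ := exists_complementary A b hI hμ (by
    intro μ' hμ' hA'
    have : p ≤ -∑ i, μ' i * b i := csSup_le hne (by
      rintro _ ⟨z, hz, rfl⟩
      exact weak μ' hμ' (fun x => (hA' x).trans (hμA x)) z hz)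
    linarith)
  refine ⟨z, μ, ⟨fun i hi => hz.1 i (Or.inl hi), fun i hi => hz.le hi.1⟩, hμ,
    fun x => (hμA x).trans (ha' x), fun i hi => hz.1 i (Or.inr hi)⟩

end LinearInequalities


/-! ### Reduction to independent supports, and the minimax principle. -/

section BasicMultipliers

variable {ι V : Type*} [Fintype ι] [AddCommGroup V] [Module ℝ V]

/-- The functionals `A i`, `i ∈ S`, are linearly independent. -/
def IndepOn (A : ι → V →ₗ[ℝ] ℝ) (S : Set ι) : Prop :=
  ∀ δ : ι → ℝ, (∀ i, i ∉ S → δ i = 0) → (∀ x, ∑ i, δ i * A i x = 0) → δ = 0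

/-- Independence makes a multiplier supported in S a function of the functional it represents. This
uniqueness leaves only finitely many basic multipliers, one at most per support. -/
theorem IndepOn.eq {A : ι → V →ₗ[ℝ] ℝ} {S : Set ι} (h : IndepOn A S) {e e' : ι → ℝ}
    (he : ∀ i, i ∉ S → e i = 0) (he' : ∀ i, i ∉ S → e' i = 0)
    (hA : ∀ x, ∑ i, e i * A i x = ∑ i, e' i * A i x) : e = e' := by
  have := h (fun i => e i - e' i) (fun i hi => by rw [he i hi, he' i hi, sub_zero]) (fun x => by
    simp only [sub_mul, Finset.sum_sub_distrib, hA, sub_self])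
  funext i
  exact sub_eq_zero.1 (congrFun this i)

/-- A nonnegative multiplier can be replaced by one with independent support, without decreasing
an objective which admits a dual feasible point. -/
theorem exists_indep_support (A : ι → V →ₗ[ℝ] ℝ) (b : ι → ℝ) {z : V} (n : ℕ) :
    ∀ lam : ι → ℝ, {i | lam i ≠ 0}.ncard ≤ n → (∀ i, 0 ≤ lam i) →
      (∀ i, lam i ≠ 0 → A i z + b i ≤ 0) →
      ∃ e : ι → ℝ, (∀ i, 0 ≤ e i) ∧ (∀ i, lam i = 0 → e i = 0) ∧
        (∀ x, ∑ i, e i * A i x = ∑ i, lam i * A i x) ∧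
        ∑ i, lam i * b i ≤ ∑ i, e i * b i ∧ IndepOn A {i | e i ≠ 0} := by
  classical
  induction n with
  | zero =>
    intro lam hcard h0 _
    have : {i | lam i ≠ 0} = ∅ := (Set.ncard_eq_zero).1 (Nat.le_zero.1 hcard)
    refine ⟨lam, h0, fun _ h => h, fun _ => rfl, le_rfl, ?_⟩
    rw [this]
    exact fun δ hδ _ => funext fun i => hδ i (by simp)
  | succ n ih =>
    intro lam hcard h0 hz
    by_cases hind : IndepOn A {i | lam i ≠ 0}
    · exact ⟨lam, h0, fun _ h => h, fun _ => rfl, le_rfl, hind⟩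
    -- A dependence relation, up to sign, gives a direction that does not decrease the objective and
    -- has a negative entry. The dual point z excludes the bad case, since a nonnegative relation
    -- can never increase the objective.
    have hdir : ∃ δ : ι → ℝ, (∀ i, lam i = 0 → δ i = 0) ∧ (∀ x, ∑ i, δ i * A i x = 0) ∧
        0 ≤ ∑ i, δ i * b i ∧ ∃ i, δ i < 0 := by
      unfold IndepOn at hind
      push Not at hind
      obtain ⟨δ, hδ, hA, hne⟩ := hind
      have hδ' : ∀ i, lam i = 0 → δ i = 0 := fun i hi => hδ i (by simpa using hi)
      have hnA : ∀ x, ∑ i, (-δ) i * A i x = 0 := fun x => by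
        simp only [Pi.neg_apply, neg_mul, Finset.sum_neg_distrib, hA, neg_zero]
      have aux : ∀ δ : ι → ℝ, (∀ i, lam i = 0 → δ i = 0) → (∀ x, ∑ i, δ i * A i x = 0) →
          (∀ i, 0 ≤ δ i) → ∑ i, δ i * b i ≤ 0 := by
        intro δ hδ hA hpos
        have h1 : ∑ i, δ i * (A i z + b i) ≤ 0 := Finset.sum_nonpos fun i _ => by
          by_cases hi : lam i = 0
          · rw [hδ i hi, zero_mul]
          · exact mul_nonpos_of_nonneg_of_nonpos (hpos i) (hz i hi)
        simp only [mul_add, Finset.sum_add_distrib, hA, zero_add] at h1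
        exact h1
      have hnb : ∑ i, (-δ) i * b i = -∑ i, δ i * b i := by simp
      by_cases hneg : ∃ i, δ i < 0
      · rcases le_or_gt 0 (∑ i, δ i * b i) with hb | hb
        · exact ⟨δ, hδ', hA, hb, hneg⟩
        · refine ⟨-δ, fun i hi => by simp [hδ' i hi], hnA, by rw [hnb]; linarith, ?_⟩
          by_contra hcon
          push Not at hcon
          have := aux (-δ) (fun i hi => by simp [hδ' i hi]) hnA hcon
          rw [hnb] at this
          linarith
      · push Not at hneg
        refine ⟨-δ, fun i hi => by simp [hδ' i hi], hnA, ?_, ?_⟩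
        · rw [hnb]
          linarith [aux δ hδ' hA hneg]
        · by_contra hcon
          push Not at hcon
          refine hne (funext fun i => le_antisymm ?_ (hneg i))
          simpa using hcon i
    obtain ⟨δ, hδ, hA, hb, i₀, hi₀⟩ := hdir
    -- Ratio test: the largest step along δ preserving nonnegativity annihilates component j, so the
    -- support strictly shrinks.
    obtain ⟨j, hj, hmin⟩ := Finset.exists_min_image
      (Finset.univ.filter fun i => δ i < 0) (fun i => lam i / -δ i) ⟨i₀, by simpa using hi₀⟩
    have hj : δ j < 0 := by simpa using hj
    set t := lam j / -δ j with ht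
    have ht0 : 0 ≤ t := div_nonneg (h0 j) (by linarith)
    have hjz : lam j + t * δ j = 0 := by
      rw [ht, div_neg, neg_mul, div_mul_cancel₀ _ hj.ne, add_neg_cancel]
    have hlamj : lam j ≠ 0 := fun h => by rw [hδ j h] at hj; exact lt_irrefl _ hj
    obtain ⟨e, he0, hes, heA, heb, hei⟩ := ih (fun i => lam i + t * δ i) (by
        have hss : {i | lam i + t * δ i ≠ 0} ⊂ {i | lam i ≠ 0} := by
          refine ⟨fun i hi h => hi ?_, fun hsub => hsub (show lam j ≠ 0 from hlamj) hjz⟩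
          rw [h, hδ i h, mul_zero, add_zero]
        have := Set.ncard_lt_ncard hss
        omega) (fun i => by
        rcases lt_or_ge (δ i) 0 with hi | hi
        · have h1 := hmin i (by simpa using hi)
          rw [le_div_iff₀ (by linarith)] at h1
          linarith
        · exact add_nonneg (h0 i) (mul_nonneg ht0 hi)) (fun i hi => hz i fun h => hi (by
          rw [h, hδ i h, mul_zero, add_zero]))
    have hexp : ∀ c : ι → ℝ, ∑ i, (lam i + t * δ i) * c i =
        ∑ i, lam i * c i + t * ∑ i, δ i * c i := by
      intro c
      rw [Finset.mul_sum, ← Finset.sum_add_distrib]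
      exact Finset.sum_congr rfl fun i _ => by ring
    refine ⟨e, he0, fun i hi => hes i (by rw [hi, hδ i hi, mul_zero, add_zero]), fun x => ?_, ?_,
      hei⟩
    · rw [heA, hexp, hA, mul_zero, add_zero]
    · rw [hexp] at heb
      linarith [mul_nonneg ht0 hb]

/-- A minimax principle: if at each point of a polyhedral cone one of finitely many functionals is
nonpositive, then a convex combination of them belongs to the polar cone. -/
theorem exists_convex_comb {κ : Type*} [Fintype κ] (A : ι → V →ₗ[ℝ] ℝ) (c : κ → V →ₗ[ℝ] ℝ)
    (P : κ → Prop) {Ip I : Set ι} (hI : Ip ⊆ I)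
    (h : ∀ u, SolvesSystem A 0 Ip I u → ∃ j, P j ∧ c j u ≤ 0) :
    ∃ (α : κ → ℝ) (μ : ι → ℝ), (∀ j, 0 ≤ α j) ∧ ∑ j, α j = 1 ∧ (∀ j, α j ≠ 0 → P j) ∧
      MixedSign Ip I μ ∧ ∀ x, ∑ i, μ i * A i x = ∑ j, α j * c j x := by
  classical
  -- The hypothesis says that A i x ≤ 0 (with equality on `Ip`) and t ≤ c j x for all admissible j
  -- imply t ≤ 0. In the Farkas certificate, comparing coefficients of t makes the weights of the c
  -- j sum to 1.
  obtain ⟨ν, hν, hsum⟩ := farkas_mixed (ι := ι ⊕ κ)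
    (Sum.elim (fun i => homogenize (A i) 0) fun j => homogenize (-c j) 1)
    (homogenize (0 : V →ₗ[ℝ] ℝ) 1) (Ip := Sum.inl '' Ip)
    (I := Sum.inl '' I ∪ Sum.inr '' {j | P j})
    ((Set.image_mono hI).trans Set.subset_union_left) (by
      rintro ⟨x, t⟩ ⟨h1, h2⟩
      obtain ⟨j, hPj, hj⟩ := h x ⟨fun i hi => by simpa using h1 (Sum.inl i) ⟨i, hi, rfl⟩,
        fun i hi => by
          simpa using h2 (Sum.inl i) ⟨Or.inl ⟨i, hi.1, rfl⟩, by simpa using hi.2⟩⟩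
      have := h2 (Sum.inr j) ⟨Or.inr ⟨j, hPj, rfl⟩, by simp⟩
      simp at this
      simp
      linarith)
  have hα : ∀ j, 0 ≤ ν (Sum.inr j) := fun j => by
    by_cases hj : P j
    · exact hν.2 _ ⟨Or.inr ⟨j, hj, rfl⟩, by simp⟩
    · exact (hν.1 _ (by simpa using hj)).ge
  refine ⟨fun j => ν (Sum.inr j), fun i => ν (Sum.inl i), hα, ?_, fun j hj => ?_,
    ⟨fun i hi => hν.1 _ (by simpa using hi), fun i hi => hν.2 _ ⟨Or.inl ⟨i, hi.1, rfl⟩,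
      by simpa using hi.2⟩⟩, fun x => ?_⟩
  · have := hsum (0, 1)
    rw [Fintype.sum_sum_type] at this
    simpa using this
  · by_contra hP
    exact hj (hν.1 _ (by simpa using hP))
  · have := hsum (x, 0)
    rw [Fintype.sum_sum_type] at this
    simp at this
    linarith

end BasicMultipliers

/-! ### Multiplier sets, optimality and complementary slackness. -/

section DirectionalMultipliers

variable {ι V : Type*} [Fintype ι] [AddCommGroup V] [Module ℝ V]

/-- Multipliers `lam ≥ 0` supported in `I` which represent the functional `ys`. -/
def MultSet (A : ι → V →ₗ[ℝ] ℝ) (I : Set ι) (ys : V →ₗ[ℝ] ℝ) : Set (ι → ℝ) :=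
  {lam | (∀ i, 0 ≤ lam i) ∧ (∀ i, i ∉ I → lam i = 0) ∧ ∀ x, ∑ i, lam i * A i x = ys x}

/-- The maximizers of the linear objective `b` over `MultSet A I ys`. -/
def MaxMultSet (A : ι → V →ₗ[ℝ] ℝ) (I : Set ι) (ys : V →ₗ[ℝ] ℝ) (b : ι → ℝ) : Set (ι → ℝ) :=
  {lam | lam ∈ MultSet A I ys ∧ ∀ lam' ∈ MultSet A I ys, ∑ i, lam' i * b i ≤ ∑ i, lam i * b i}

/-- The cone `{u | A i u ≤ 0 (i ∈ I), ys u = 0}`. -/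
def CritCone (A : ι → V →ₗ[ℝ] ℝ) (I : Set ι) (ys : V →ₗ[ℝ] ℝ) : Set V :=
  {u | (∀ i ∈ I, A i u ≤ 0) ∧ ys u = 0}

variable {A : ι → V →ₗ[ℝ] ℝ} {I : Set ι} {ys : V →ₗ[ℝ] ℝ} {b : ι → ℝ}

theorem MultSet.mixedSign {lam : ι → ℝ} (h : lam ∈ MultSet A I ys) : MixedSign ∅ I lam :=
  ⟨h.2.1, fun i _ => h.1 i⟩

theorem MixedSign.mem_multSet {lam : ι → ℝ} (h : MixedSign ∅ I lam)
    (hA : ∀ x, ∑ i, lam i * A i x = ys x) : lam ∈ MultSet A I ys := by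
  refine ⟨fun i => ?_, h.1, hA⟩
  by_cases hi : i ∈ I
  · exact h.2 i ⟨hi, by simp⟩
  · exact (h.1 i hi).ge

/-- Weak duality together with complementarity gives optimality. -/
theorem mem_maxMultSet_of_complementary {lam : ι → ℝ} (h : lam ∈ MultSet A I ys) {z : V}
    (hz : ∀ i ∈ I, A i z + b i ≤ 0) (hc : ∀ i, lam i ≠ 0 → A i z + b i = 0) :
    lam ∈ MaxMultSet A I ys b := by
  refine ⟨h, fun lam' h' => ?_⟩
  have h1 : ∑ i, lam' i * (A i z + b i) ≤ 0 := Finset.sum_nonpos fun i _ => by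
    by_cases hi : i ∈ I
    · exact mul_nonpos_of_nonneg_of_nonpos (h'.1 i) (hz i hi)
    · rw [h'.2.1 i hi, zero_mul]
  have h2 : ∑ i, lam i * (A i z + b i) = 0 := Finset.sum_eq_zero fun i _ => by
    by_cases hi : lam i = 0
    · rw [hi, zero_mul]
    · rw [hc i hi, mul_zero]
  simp only [mul_add, Finset.sum_add_distrib] at h1 h2
  rw [h'.2.2] at h1
  rw [h.2.2] at h2
  linarith

theorem MaxMultSet.sum_eq {lam lam' : ι → ℝ} (h : lam ∈ MaxMultSet A I ys b)
    (h' : lam' ∈ MaxMultSet A I ys b) : ∑ i, lam i * b i = ∑ i, lam' i * b i :=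
  le_antisymm (h'.2 _ h.1) (h.2 _ h'.1)

/-- A dual solution for one optimal multiplier is complementary to all optimal multipliers. -/
theorem MaxMultSet.complementary {lam lam' : ι → ℝ} (h : lam ∈ MaxMultSet A I ys b)
    (h' : lam' ∈ MaxMultSet A I ys b) {z : V} (hz : ∀ i ∈ I, A i z + b i ≤ 0)
    (hc : ∀ i, lam i ≠ 0 → A i z + b i = 0) {i : ι} (hi : lam' i ≠ 0) : A i z + b i = 0 := by
  have h2 : ∑ i, lam i * (A i z + b i) = 0 := Finset.sum_eq_zero fun i _ => by
    by_cases hi : lam i = 0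
    · rw [hi, zero_mul]
    · rw [hc i hi, mul_zero]
  have h3 : ∑ i, lam' i * (A i z + b i) = 0 := by
    simp only [mul_add, Finset.sum_add_distrib] at h2 ⊢
    rw [h'.1.2.2, ← h.1.2.2 z, ← MaxMultSet.sum_eq h h', h2]
  have hle : ∀ i ∈ Finset.univ, lam' i * (A i z + b i) ≤ 0 := fun i _ => by
    by_cases hi : i ∈ I
    · exact mul_nonpos_of_nonneg_of_nonpos (h'.1.1 i) (hz i hi)
    · rw [h'.1.2.1 i hi, zero_mul]
  have := (Finset.sum_eq_zero_iff_of_nonpos hle).1 h3 i (Finset.mem_univ i)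
  exact (mul_eq_zero.1 this).resolve_left hi

/-- Turns optimality into a linear system, a form that can be passed to a limit and shared by all
optimal multipliers. -/
theorem MaxMultSet.exists_dual {lam : ι → ℝ} (h : lam ∈ MaxMultSet A I ys b) :
    ∃ z, (∀ i ∈ I, A i z + b i ≤ 0) ∧ ∀ i, lam i ≠ 0 → A i z + b i = 0 := by
  obtain ⟨z, hz⟩ := exists_complementary A b (Set.empty_subset I) (MultSet.mixedSign h.1)
    (fun μ' hμ' hA => h.2 μ' (hμ'.mem_multSet fun x => (hA x).trans (h.1.2.2 x)))
  exact ⟨z, fun i hi => hz.le hi, fun i hi => hz.1 i (Or.inr hi)⟩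

/-- Strong duality yields a maximizer with a dual solution. The dual solution then permits shrinking
the support to an independent one without losing value. -/
theorem exists_basic_maximizer (hne : (MultSet A I ys).Nonempty)
    (hz : ∃ z, ∀ i ∈ I, A i z + b i ≤ 0) :
    ∃ e ∈ MaxMultSet A I ys b, IndepOn A {i | e i ≠ 0} := by
  obtain ⟨lam₀, h₀⟩ := hne
  obtain ⟨z₀, hz₀⟩ := hz
  obtain ⟨z, μ, hzs, hμ, hμA, hc⟩ := exists_complementary_pair A b (Set.empty_subset I)
    (MultSet.mixedSign h₀) ⟨z₀, by simp, fun i hi => hz₀ i hi.1⟩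
  have hμm : μ ∈ MaxMultSet A I ys b := mem_maxMultSet_of_complementary
    (hμ.mem_multSet fun x => (hμA x).trans (h₀.2.2 x)) (fun i hi => hzs.le hi) hc
  obtain ⟨e, he0, hes, heA, heb, hei⟩ := exists_indep_support A b (z := z) _ μ le_rfl hμm.1.1
    (fun i hi => (hc i hi).le)
  refine ⟨e, ⟨⟨he0, fun i hi => hes i (hμm.1.2.1 i hi), fun x => (heA x).trans (hμm.1.2.2 x)⟩,
    fun lam' h' => (hμm.2 lam' h').trans heb⟩, hei⟩

theorem MultSet.eq_zero_of_mem_critCone {lam : ι → ℝ} (h : lam ∈ MultSet A I ys) {u : V}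
    (hu : u ∈ CritCone A I ys) {i : ι} (hi : lam i ≠ 0) : A i u = 0 := by
  have hle : ∀ i ∈ Finset.univ, lam i * A i u ≤ 0 := fun i _ => by
    by_cases hi : i ∈ I
    · exact mul_nonpos_of_nonneg_of_nonpos (h.1 i) (hu.1 i hi)
    · rw [h.2.1 i hi, zero_mul]
  have := (Finset.sum_eq_zero_iff_of_nonpos hle).1 ((h.2.2 u).trans hu.2) i (Finset.mem_univ i)
  exact (mul_eq_zero.1 this).resolve_left hi

theorem MultSet.mem_critCone {lam : ι → ℝ} (h : lam ∈ MultSet A I ys) {u : V}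
    (hu : ∀ i ∈ I, A i u ≤ 0) (hz : ∀ i, lam i ≠ 0 → A i u = 0) : u ∈ CritCone A I ys := by
  refine ⟨hu, ?_⟩
  rw [← h.2.2 u]
  refine Finset.sum_eq_zero fun i _ => ?_
  by_cases hi : lam i = 0
  · rw [hi, zero_mul]
  · rw [hz i hi, mul_zero]

end DirectionalMultipliers


/-! ### From polar inequalities to a convex combination of extremal multipliers. -/

section PolarConditions

variable {ι V : Type*} [Fintype ι] [AddCommGroup V] [Module ℝ V]
  {A : ι → V →ₗ[ℝ] ℝ} {I : Set ι} {ys ws : V →ₗ[ℝ] ℝ} {B : ι → V →ₗ[ℝ] V →ₗ[ℝ] ℝ} {w vt : V}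

/-- The maximizers of `∑ i, lam i * B i v v` over `MultSet A I ys`. -/
def DirMultSet (A : ι → V →ₗ[ℝ] ℝ) (I : Set ι) (ys : V →ₗ[ℝ] ℝ) (B : ι → V →ₗ[ℝ] V →ₗ[ℝ] ℝ)
    (v : V) : Set (ι → ℝ) :=
  MaxMultSet A I ys fun i => B i v v

theorem mem_dirMultSet_neg {v : V} {e : ι → ℝ} (h : e ∈ DirMultSet A I ys B v) :
    e ∈ DirMultSet A I ys B (-v) := by
  simpa [DirMultSet, MaxMultSet] using h

theorem nullVector_mem_critCone (hne : (MultSet A I ys).Nonempty) (hvt : ∀ i ∈ I, A i vt = 0) :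
    vt ∈ CritCone A I ys := by
  obtain ⟨lam, hlam⟩ := hne
  refine MultSet.mem_critCone hlam (fun i hi => (hvt i hi).le) fun i hi => hvt i ?_
  by_contra h
  exact hi (hlam.2.1 i h)

omit [Fintype ι] in
theorem add_smul_mem_critCone {u v : V} (hu : u ∈ CritCone A I ys) (hv : v ∈ CritCone A I ys)
    {s : ℝ} (hs : 0 ≤ s) : v + s • u ∈ CritCone A I ys := by
  refine ⟨fun i hi => ?_, ?_⟩
  · rw [map_add, map_smul, smul_eq_mul]
    exact add_nonpos (hv.1 i hi) (mul_nonpos_of_nonneg_of_nonpos hs (hu.1 i hi))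
  · rw [map_add, map_smul, hu.2, hv.2, smul_zero, add_zero]

/-- Both `vt` and `-vt` are critical and have the same maximizers, because the objective is
quadratic in the direction; the two polar inequalities are opposite. -/
theorem polar_eq_zero_of_nullVector (hne : (MultSet A I ys).Nonempty)
    (h2 : ∀ v ∈ CritCone A I ys, ∀ lam ∈ DirMultSet A I ys B v,
      ws v + ∑ i, lam i * B i v w ≤ 0)
    (hvt : ∀ i ∈ I, A i vt = 0) {e : ι → ℝ} (he : e ∈ DirMultSet A I ys B vt) :
    ws vt + ∑ i, e i * B i vt w = 0 := by
  have h1 := h2 vt (nullVector_mem_critCone hne hvt) e he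
  have h3 := h2 (-vt) (nullVector_mem_critCone hne fun i hi => by rw [map_neg, hvt i hi, neg_zero])
    e (mem_dirMultSet_neg he)
  simp only [map_neg, LinearMap.neg_apply, mul_neg, Finset.sum_neg_distrib] at h3
  linarith

/-- Extremal directional multipliers at a null vector for which a given critical direction
satisfies the polar inequality. -/
theorem exists_extremal_multiplier (hne : (MultSet A I ys).Nonempty)
    (h2 : ∀ v ∈ CritCone A I ys, ∀ lam ∈ DirMultSet A I ys B v,
      ws v + ∑ i, lam i * B i v w ≤ 0)
    (h3 : ∀ v ∈ CritCone A I ys, ∃ z, ∀ i ∈ I, A i z + B i v v ≤ 0)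
    (hvt : ∀ i ∈ I, A i vt = 0) {u : V} (hu : u ∈ CritCone A I ys) (hne0 : vt ≠ 0 ∨ u ≠ 0) :
    ∃ e ∈ DirMultSet A I ys B vt, IndepOn A {i | e i ≠ 0} ∧
      (∃ u' ∈ CritCone A I ys, (u' ≠ 0 ∧ (vt ≠ 0 → u' = vt)) ∧ e ∈ DirMultSet A I ys B u') ∧
      ws u + ∑ i, e i * B i u w ≤ 0 := by
  classical
  have hvtK := nullVector_mem_critCone hne hvt
  let P : Finset ι → ℝ → Prop := fun S s => ∃ e, (∀ i, e i ≠ 0 ↔ i ∈ S) ∧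
    e ∈ DirMultSet A I ys B (vt + s • u) ∧ IndepOn A {i | e i ≠ 0}
  have hP : ∀ s : ℝ, 0 < s → ∃ S, P S s := by
    intro s hs
    obtain ⟨e, he, hei⟩ := exists_basic_maximizer hne (h3 _ (add_smul_mem_critCone hu hvtK hs.le))
    exact ⟨Finset.univ.filter fun i => e i ≠ 0, e, by simp, he, hei⟩
  -- Finitely many supports are available, so one recurs for arbitrarily small s; by independence
  -- the multiplier itself is then the same each time.
  have hfr : ∃ S, ∃ᶠ s in 𝓝[>] (0 : ℝ), P S s := by
    by_contra hcon
    have hcon' : ∀ S, ∀ᶠ s in 𝓝[>] (0 : ℝ), ¬ P S s := fun S =>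
      not_frequently.1 fun h => hcon ⟨S, h⟩
    obtain ⟨s, hs, hs0⟩ := ((eventually_all.2 hcon').and
      (self_mem_nhdsWithin : Set.Ioi (0 : ℝ) ∈ 𝓝[>] 0)).exists
    obtain ⟨S, hS⟩ := hP s hs0
    exact hs S hS
  obtain ⟨S, hS⟩ := hfr
  have hS' := hS.and_eventually (self_mem_nhdsWithin : Set.Ioi (0 : ℝ) ∈ 𝓝[>] 0)
  obtain ⟨s₀, ⟨e, heS, he, hei⟩, hs₀⟩ := hS'.exists
  have hs₀ : 0 < s₀ := hs₀
  have heall : ∃ᶠ s in 𝓝[>] (0 : ℝ), e ∈ DirMultSet A I ys B (vt + s • u) := by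
    refine hS.mono ?_
    rintro s ⟨e', he'S, he', -⟩
    have : e = e' := hei.eq (fun i hi => by simpa using hi)
      (fun i hi => by
        by_contra h
        exact hi ((heS i).2 ((he'S i).1 h)))
      (fun x => (he.1.2.2 x).trans (he'.1.2.2 x).symm)
    rw [this]; exact he'
  have hevt : e ∈ DirMultSet A I ys B vt := by
    refine ⟨he.1, fun lam' h' => ?_⟩
    have hcont : ∀ d : ι → ℝ, Tendsto
        (fun s : ℝ => ∑ i, d i * (B i (vt + s • u)) (vt + s • u)) (𝓝[>] 0)
        (𝓝 (∑ i, d i * B i vt vt)) := by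
      intro d
      have hc : Continuous fun s : ℝ => ∑ i, d i * (B i (vt + s • u)) (vt + s • u) := by
        simp only [map_add, map_smul, LinearMap.add_apply, LinearMap.smul_apply, smul_eq_mul]
        fun_prop
      have := (hc.tendsto 0).mono_left (nhdsWithin_le_nhds (s := Set.Ioi (0 : ℝ)))
      simpa using this
    have hsub := (hcont lam').sub (hcont e)
    have hfr2 : ∃ᶠ s in 𝓝[>] (0 : ℝ), ∑ i, lam' i * (B i (vt + s • u)) (vt + s • u) -
        ∑ i, e i * (B i (vt + s • u)) (vt + s • u) ≤ 0 :=
      heall.mono fun s hs => sub_nonpos.2 (hs.2 lam' h')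
    exact sub_nonpos.1 (le_of_tendsto_of_frequently hsub hfr2)
  refine ⟨e, hevt, hei, ?_, ?_⟩
  · by_cases h0 : vt = 0
    -- At `vt = 0` every multiplier is maximal, so the nonzero direction `s₀ • u` is what records
    -- the restriction on e.
    · refine ⟨s₀ • u, ?_, ⟨smul_ne_zero hs₀.ne' (hne0.resolve_left (not_not.2 h0)), fun h => absurd h0 h⟩, ?_⟩
      · simpa [h0] using add_smul_mem_critCone hu hvtK hs₀.le
      · simpa [h0] using he
    · exact ⟨vt, hvtK, ⟨h0, fun _ => rfl⟩, hevt⟩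
  -- With e fixed the inequality is affine in s and vanishes at s = 0, so the single value `s₀`
  -- suffices.
  · have h4 := h2 _ (add_smul_mem_critCone hu hvtK hs₀.le) e he
    have h5 := polar_eq_zero_of_nullVector hne h2 hvt hevt
    simp only [map_add, map_smul, LinearMap.add_apply, LinearMap.smul_apply, smul_eq_mul, mul_add,
      Finset.sum_add_distrib] at h4
    have h6 : ∑ i, e i * (s₀ * B i u w) = s₀ * ∑ i, e i * B i u w := by
      rw [Finset.mul_sum]
      exact Finset.sum_congr rfl fun i _ => by ring
    rw [h6] at h4
    have h7 : s₀ * (ws u + ∑ i, e i * B i u w) ≤ 0 := by linarith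
    exact nonpos_of_mul_nonpos_right h7 hs₀

/-- The data extracted from a regular normal `(ws, w)` at a multiplier `ys` and a null vector
`vt`: index sets `Ip ⊆ {i ∈ I | A i z₀ + B i vt vt = 0}`, and a convex combination with weights `α`
of extremal multipliers `e S`, each optimal in the direction `u S`. -/
structure PolarData (A : ι → V →ₗ[ℝ] ℝ) (I : Set ι) (ys : V →ₗ[ℝ] ℝ)
    (B : ι → V →ₗ[ℝ] V →ₗ[ℝ] ℝ) (ws : V →ₗ[ℝ] ℝ) (w vt : V) (Ip : Set ι) (z₀ : V)
    (α : Finset ι → ℝ) (e : Finset ι → ι → ℝ) (u : Finset ι → V) : Prop where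
  feasible : ∀ i ∈ I, A i z₀ + B i vt vt ≤ 0
  subset : Ip ⊆ {i | i ∈ I ∧ A i z₀ + B i vt vt = 0}
  solves : SolvesSystem A 0 Ip {i | i ∈ I ∧ A i z₀ + B i vt vt = 0} w
  solvesDir : ∃ z, SolvesSystem A (fun i => B i vt w) Ip {i | i ∈ I ∧ A i z₀ + B i vt vt = 0} z
  nonneg : ∀ S, 0 ≤ α S
  sum_eq_one : ∑ S, α S = 1
  extremal : ∀ S, α S ≠ 0 → e S ∈ DirMultSet A I ys B (u S) ∧ IndepOn A S ∧
    (∀ i, i ∉ S → e S i = 0) ∧ (S : Set ι) ⊆ Ip ∧ u S ∈ CritCone A I ys ∧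
    (u S ≠ 0 ∧ (vt ≠ 0 → u S = vt))
  polar : ∃ μ, MixedSign Ip {i | i ∈ I ∧ A i z₀ + B i vt vt = 0} μ ∧
    ∀ x, ∑ i, μ i * A i x = ws x + ∑ S, α S * ∑ i, e S i * B i x w

/-- `Ip` collects the supports of all maximizers at `vt`, so the cone it defines lies in the
critical cone. Minimax on that cone gives the convex combination, and two linear programs, with
objectives B i vt vt and B i vt w, give `z₀` and the vector of `solvesDir`. -/
theorem exists_polarData (hne : (MultSet A I ys).Nonempty) (h1 : w ∈ CritCone A I ys)
    (h2 : ∀ v ∈ CritCone A I ys, ∀ lam ∈ DirMultSet A I ys B v,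
      ws v + ∑ i, lam i * B i v w ≤ 0)
    (h3 : ∀ v ∈ CritCone A I ys, ∃ z, ∀ i ∈ I, A i z + B i v v ≤ 0)
    (hvt : ∀ i ∈ I, A i vt = 0) (hnt : ∃ u ∈ CritCone A I ys, vt ≠ 0 ∨ u ≠ 0) :
    ∃ Ip z₀ α e u, PolarData A I ys B ws w vt Ip z₀ α e u := by
  classical
  obtain ⟨u₀, hu₀, hu₀'⟩ := hnt
  obtain ⟨e₀, he₀, -⟩ := exists_extremal_multiplier hne h2 h3 hvt hu₀ hu₀'
  set Ip : Set ι := {i | ∃ lam ∈ DirMultSet A I ys B vt, lam i ≠ 0} with hIp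
  have hIpI : Ip ⊆ I := by
    rintro i ⟨lam, hlam, hi⟩
    by_contra h
    exact hi (hlam.1.2.1 i h)
  have hK : ∀ u, SolvesSystem A 0 Ip I u → u ∈ CritCone A I ys := fun u hu =>
    MultSet.mem_critCone he₀.1 (fun i hi => by simpa using hu.le hi)
      fun i hi => by simpa using hu.1 i ⟨e₀, he₀, hi⟩
  let P : Finset ι → (ι → ℝ) → V → Prop := fun S e u' =>
    e ∈ DirMultSet A I ys B vt ∧ IndepOn A {i | e i ≠ 0} ∧ (∀ i, e i ≠ 0 ↔ i ∈ S) ∧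
      u' ∈ CritCone A I ys ∧ (u' ≠ 0 ∧ (vt ≠ 0 → u' = vt)) ∧ e ∈ DirMultSet A I ys B u'
  -- One representative multiplier and direction is selected per support, making the family of
  -- functionals finite.
  have hch : ∀ S, ∃ e u', (∃ e u', P S e u') → P S e u' := by
    intro S
    by_cases h : ∃ e u', P S e u'
    · obtain ⟨e, u', h'⟩ := h
      exact ⟨e, u', fun _ => h'⟩
    · exact ⟨0, 0, fun h' => absurd h' h⟩
  choose e u hP using hch
  let c : Finset ι → V →ₗ[ℝ] ℝ := fun S => ws + ∑ i, e S i • (B i).flip w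
  have hc : ∀ S x, c S x = ws x + ∑ i, e S i * B i x w := fun S x => by
    simp [c, LinearMap.sum_apply]
  have hkey : ∀ u' ∈ CritCone A I ys, (vt ≠ 0 ∨ u' ≠ 0) →
      ∃ S, (∃ e u', P S e u') ∧ c S u' ≤ 0 := by
    intro u' hu' h0
    obtain ⟨e', he', hei, ⟨u'', hu'', hu''0, heu⟩, hle⟩ :=
      exists_extremal_multiplier hne h2 h3 hvt hu' h0
    let S : Finset ι := Finset.univ.filter fun i => e' i ≠ 0
    have hex : ∃ e u', P S e u' := ⟨e', u'', he', hei, by simp [S], hu'', hu''0, heu⟩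
    refine ⟨S, hex, ?_⟩
    have hPS := hP S hex
    have : e S = e' := hei.eq (fun i hi => by
        by_contra h
        exact hi (by simpa [S] using (hPS.2.2.1 i).1 h))
      (fun i hi => by simpa using hi) (fun x => (hPS.1.1.2.2 x).trans (he'.1.2.2 x).symm)
    rw [hc, this]
    exact hle
  obtain ⟨α, μ, hα0, hα1, hαP, hμ, hμA⟩ := exists_convex_comb A c (fun S => ∃ e u', P S e u')
    hIpI (by
      intro u' hu'
      by_cases h0 : vt ≠ 0 ∨ u' ≠ 0
      · exact hkey u' (hK u' hu') h0
      · push Not at h0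
        obtain ⟨S, hS, -⟩ := hkey u₀ hu₀ hu₀'
        exact ⟨S, hS, by rw [h0.2, map_zero]⟩)
  obtain ⟨z₁, hz₁, hz₁c⟩ := MaxMultSet.exists_dual he₀
  have hz₁s : SolvesSystem A (fun i => B i vt vt) Ip I z₁ := by
    refine ⟨?_, fun i hi => hz₁ i hi.1⟩
    rintro i ⟨lam, hlam, hi⟩
    exact MaxMultSet.complementary he₀ hlam hz₁ hz₁c hi
  -- The polar multiplier μ is exchanged for μ', representing the same functional but complementary
  -- to a dual solution `z₀`; hence μ' is supported in the active set J of `z₀`.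
  obtain ⟨z₀, μ', hz₀, hμ', hμ'A, hμ'c⟩ := exists_complementary_pair A (fun i => B i vt vt) hIpI hμ
    ⟨z₁, hz₁s⟩
  set J : Set ι := {i | i ∈ I ∧ A i z₀ + B i vt vt = 0} with hJ
  have hIpJ : Ip ⊆ J := fun i hi => ⟨hIpI hi, hz₀.1 i hi⟩
  have hJopt : ∀ lam, lam ∈ MultSet A J ys ↔ lam ∈ DirMultSet A I ys B vt := by
    intro lam
    constructor
    · intro h
      refine mem_maxMultSet_of_complementary ⟨h.1, fun i hi => h.2.1 i fun h' => hi h'.1, h.2.2⟩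
        (fun i hi => hz₀.le hi) fun i hi => ?_
      by_contra hcon
      exact hi (h.2.1 i fun h' => hcon h'.2)
    · intro h
      refine ⟨h.1.1, fun i hi => ?_, h.1.2.2⟩
      by_contra hcon
      exact hi (hIpJ ⟨lam, h, hcon⟩)
  -- Multipliers supported in J are exactly the maximizers at `vt`, and the polar equality there
  -- fixes the value of ∑ lam_i B i vt w. The objective is constant, so every such multiplier is
  -- optimal for it.
  have hmaxw : ∀ lam ∈ MultSet A J ys, lam ∈ MaxMultSet A J ys fun i => B i vt w := by
    intro lam hlam
    refine ⟨hlam, fun lam' h' => ?_⟩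
    have e1 := polar_eq_zero_of_nullVector hne h2 hvt ((hJopt lam).1 hlam)
    have e2 := polar_eq_zero_of_nullVector hne h2 hvt ((hJopt lam').1 h')
    linarith
  obtain ⟨z', hz', hz'c⟩ := MaxMultSet.exists_dual (hmaxw e₀ ((hJopt e₀).2 he₀))
  refine ⟨Ip, z₀, α, e, u, fun i hi => hz₀.le hi, hIpJ, ⟨fun i hi => ?_, fun i hi => ?_⟩,
    ⟨z', fun i hi => ?_, fun i hi => hz' i hi.1⟩, hα0, hα1, fun S hS => ?_, μ',
    ⟨fun i hi => ?_, fun i hi => hμ'.2 i ⟨hi.1.1, hi.2⟩⟩, fun x => ?_⟩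
  · obtain ⟨lam, hlam, hi⟩ := hi
    simpa using MultSet.eq_zero_of_mem_critCone hlam.1 h1 hi
  · simpa using h1.1 i hi.1.1
  · obtain ⟨lam, hlam, hi⟩ := hi
    exact MaxMultSet.complementary (hmaxw e₀ ((hJopt e₀).2 he₀))
      (hmaxw lam ((hJopt lam).2 hlam)) hz' hz'c hi
  · obtain ⟨hPe, hPi, hPS, hPu, hPu0, hPeu⟩ := hP S (hαP S hS)
    have hSe : (S : Set ι) = {i | e S i ≠ 0} := by
      ext i; exact (hPS i).symm
    refine ⟨hPeu, hSe ▸ hPi, fun i hi => ?_, fun i hi => ⟨e S, hPe, (hPS i).2 hi⟩, hPu, hPu0⟩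
    by_contra h
    exact hi ((hPS i).1 h)
  · by_contra hcon
    by_cases hiI : i ∈ I
    · exact hi ⟨hiI, hμ'c i hcon⟩
    · exact hcon (hμ'.1 i hiI)
  · rw [hμ'A, hμA]
    simp only [hc, mul_add, Finset.sum_add_distrib]
    rw [← Finset.sum_mul, hα1, one_mul]

end PolarConditions


/-! ### Stability of linear systems and multipliers under limits. -/

section Limits

variable {ι V : Type*} [Fintype ι] [AddCommGroup V] [Module ℝ V]
  {A : ι → V →ₗ[ℝ] ℝ} {I : Set ι} {ys : V →ₗ[ℝ] ℝ}

/-- A dual basis: each coefficient is read off by evaluating the represented functional at one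
vector. Convergence of functionals thus forces convergence of multipliers supported in S. -/
theorem IndepOn.exists_dual {S : Set ι} (h : IndepOn A S) (i : ι) :
    ∃ x, ∀ e : ι → ℝ, (∀ j, j ∉ S → e j = 0) → ∑ j, e j * A j x = e i := by
  classical
  by_cases hi : i ∈ S
  · rcases system_alternative A (fun j => if j = i then -1 else 0) (Set.Subset.refl S) with
      ⟨x, hx⟩ | ⟨δ, hδ, hA, hb⟩
    · refine ⟨x, fun e he => ?_⟩
      rw [Finset.sum_eq_single i]
      · have := hx.1 i hi
        simp only [if_true] at this
        rw [show A i x = 1 by linarith, mul_one]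
      · intro j _ hj
        by_cases hjS : j ∈ S
        · have := hx.1 j hjS
          simp only [if_neg hj, add_zero] at this
          rw [this, mul_zero]
        · rw [he j hjS, zero_mul]
      · simp
    · rw [h δ hδ.1 hA] at hb
      simp at hb
  · exact ⟨0, fun e he => by simp [he i hi]⟩

/-- Solvability of a linear system is a closed condition on the right-hand side. -/
theorem exists_solvesSystem_of_tendsto {b : ι → ℝ} {bs : ℕ → ι → ℝ} {Ip : Set ι} (hI : Ip ⊆ I)
    (hb : ∀ i, Tendsto (fun k => bs k i) atTop (𝓝 (b i)))
    (h : ∀ᶠ k in atTop, ∃ z, SolvesSystem A (bs k) Ip I z) : ∃ z, SolvesSystem A b Ip I z := by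
  -- Only the right-hand side varies, so a certificate of insolubility for the limit remains one for
  -- nearby right-hand sides.
  rcases system_alternative A b hI with hz | ⟨δ, hδ, hA, hpos⟩
  · exact hz
  exfalso
  have hlim : Tendsto (fun k => ∑ i, δ i * bs k i) atTop (𝓝 (∑ i, δ i * b i)) :=
    tendsto_finsetSum _ fun i _ => (hb i).const_mul (δ i)
  obtain ⟨k, hk, z, hz⟩ := ((hlim.eventually (lt_mem_nhds hpos)).and h).exists
  have := hδ.sum_mul_nonpos hz
  simp only [mul_add, Finset.sum_add_distrib, hA, zero_add] at this
  linarith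

/-- The derivative of a curve of represented functionals is represented by a multiplier which is
nonnegative where the limit multiplier vanishes. -/
theorem exists_tangent_multiplier {vs : V →ₗ[ℝ] ℝ} {yss : ℕ → V →ₗ[ℝ] ℝ} {t : ℕ → ℝ}
    (ht : ∀ k, 0 < t k) (hvs : ∀ x, Tendsto (fun k => (t k)⁻¹ * (yss k x - ys x)) atTop (𝓝 (vs x)))
    {lam : ι → ℝ} (hlam : lam ∈ MultSet A I ys) {lams : ℕ → ι → ℝ}
    (hlams : ∀ k, lams k ∈ MultSet A I (yss k)) {Ip : Set ι} (hIp : ∀ i, lam i ≠ 0 → i ∈ Ip)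
    (hIps : ∀ k i, lams k i ≠ 0 → i ∈ Ip) :
    ∃ μ, MixedSign {i | lam i ≠ 0} Ip μ ∧ ∀ x, ∑ i, μ i * A i x = vs x := by
  -- The multipliers `lams k` need not converge to `lam`: it is enough that, on the cone given by
  -- `lam` and `Ip`, each increment of the functional is nonpositive.
  refine farkas_mixed A vs hIp fun x hx => ?_
  refine le_of_tendsto (hvs x) (Eventually.of_forall fun k => ?_)
  refine mul_nonpos_of_nonneg_of_nonpos (inv_pos.2 (ht k)).le ?_
  rw [← (hlams k).2.2 x, ← hlam.2.2 x, ← Finset.sum_sub_distrib]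
  refine Finset.sum_nonpos fun i _ => ?_
  by_cases h0 : lam i = 0
  · rw [h0, zero_mul, sub_zero]
    by_cases h1 : lams k i = 0
    · rw [h1, zero_mul]
    · exact mul_nonpos_of_nonneg_of_nonpos ((hlams k).1 i)
        (by simpa using hx.le (hIps k i h1))
  · have : A i x = 0 := by simpa using hx.1 i h0
    rw [this, mul_zero, mul_zero, sub_zero]

theorem mem_multSet_of_tendsto {yss : ℕ → V →ₗ[ℝ] ℝ}
    (hys : ∀ x, Tendsto (fun k => yss k x) atTop (𝓝 (ys x))) {lam : ι → ℝ} {lams : ℕ → ι → ℝ}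
    (hl : ∀ i, Tendsto (fun k => lams k i) atTop (𝓝 (lam i)))
    (h : ∀ k, lams k ∈ MultSet A I (yss k)) : lam ∈ MultSet A I ys := by
  refine ⟨fun i => ge_of_tendsto' (hl i) fun k => (h k).1 i, fun i hi => ?_, fun x => ?_⟩
  · refine tendsto_nhds_unique (hl i) ?_
    simp only [fun k => (h k).2.1 i hi]
    exact tendsto_const_nhds
  · have h1 : Tendsto (fun k => ∑ i, lams k i * A i x) atTop (𝓝 (∑ i, lam i * A i x)) :=
      tendsto_finsetSum _ fun i _ => (hl i).mul_const _
    simp only [fun k => (h k).2.2 x] at h1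
    exact tendsto_nhds_unique h1 (hys x)

theorem convexComb_mem_multSet {κ : Type*} [Fintype κ] {α : κ → ℝ} {e : κ → ι → ℝ}
    (h0 : ∀ S, 0 ≤ α S) (h1 : ∑ S, α S = 1) (he : ∀ S, α S ≠ 0 → e S ∈ MultSet A I ys) :
    (fun i => ∑ S, α S * e S i) ∈ MultSet A I ys := by
  refine ⟨fun i => Finset.sum_nonneg fun S _ => ?_, fun i hi => Finset.sum_eq_zero fun S _ => ?_,
    fun x => ?_⟩
  · by_cases hS : α S = 0
    · rw [hS, zero_mul]
    · exact mul_nonneg (h0 S) ((he S hS).1 i)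
  · by_cases hS : α S = 0
    · rw [hS, zero_mul]
    · rw [(he S hS).2.1 i hi, mul_zero]
  · calc ∑ i, (∑ S, α S * e S i) * A i x = ∑ S, α S * ∑ i, e S i * A i x := by
          simp only [Finset.sum_mul, Finset.mul_sum]
          rw [Finset.sum_comm]
          exact Finset.sum_congr rfl fun S _ => Finset.sum_congr rfl fun i _ => by ring
      _ = ∑ S, α S * ys x := Finset.sum_congr rfl fun S _ => by
          by_cases hS : α S = 0
          · rw [hS, zero_mul, zero_mul]
          · rw [(he S hS).2.2 x]
      _ = ys x := by rw [← Finset.sum_mul, h1, one_mul]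

end Limits

/-! ### Passing the polar data to the limit. -/

section PolarLimits

variable {ι V : Type*} [Fintype ι] [NormedAddCommGroup V] [NormedSpace ℝ V]
  [FiniteDimensional ℝ V]
  {A : ι → V →ₗ[ℝ] ℝ} {I : Set ι} {ys ws vs : V →ₗ[ℝ] ℝ} {B : ι → V →ₗ[ℝ] V →ₗ[ℝ] ℝ} {w vt : V}

omit [FiniteDimensional ℝ V] in
theorem mem_dirMultSet_smul {u : V} {e : ι → ℝ} (h : e ∈ DirMultSet A I ys B u) (c : ℝ) :
    e ∈ DirMultSet A I ys B (c • u) := by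
  refine ⟨h.1, fun lam' h' => ?_⟩
  have key : ∀ d : ι → ℝ, ∑ i, d i * B i (c • u) (c • u) = c ^ 2 * ∑ i, d i * B i u u := by
    intro d
    rw [Finset.mul_sum]
    refine Finset.sum_congr rfl fun i _ => ?_
    simp only [map_smul, LinearMap.smul_apply, smul_eq_mul]
    ring
  simp only [key]
  exact mul_le_mul_of_nonneg_left (h.2 lam' h') (sq_nonneg c)

-- The feasible sets vary with k, so maximality cannot be compared pointwise. Instead the
-- complementary dual systems pass to the limit, using that the support of e is eventually contained
-- in that of `es k`.
omit [FiniteDimensional ℝ V] in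
theorem dirMultSet_of_tendsto (hB : ∀ i, Continuous fun p : V × V => B i p.1 p.2)
    {yss : ℕ → V →ₗ[ℝ] ℝ} {u : V} {us : ℕ → V} (hu : Tendsto us atTop (𝓝 u)) {e : ι → ℝ}
    {es : ℕ → ι → ℝ} (he : ∀ i, Tendsto (fun k => es k i) atTop (𝓝 (e i)))
    (heM : e ∈ MultSet A I ys) (h : ∀ k, es k ∈ DirMultSet A I (yss k) B (us k)) :
    e ∈ DirMultSet A I ys B u := by
  have hsub : {i | e i ≠ 0} ⊆ I := fun i hi => by
    by_contra h'
    exact hi (heM.2.1 i h')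
  obtain ⟨z, hz⟩ := exists_solvesSystem_of_tendsto (A := A) (b := fun i => B i u u)
    (bs := fun k i => B i (us k) (us k)) hsub
    (fun i => (((hB i).tendsto (u, u)).comp (hu.prodMk_nhds hu) :)) (by
      have hev : ∀ᶠ k in atTop, ∀ i, e i ≠ 0 → es k i ≠ 0 := by
        rw [eventually_all]
        intro i
        by_cases hi : e i = 0
        · exact Eventually.of_forall fun k h => absurd hi h
        · filter_upwards [(he i).eventually_ne hi] with k hk _ using hk
      filter_upwards [hev] with k hk
      obtain ⟨z, hz, hzc⟩ := MaxMultSet.exists_dual (h k)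
      exact ⟨z, fun i hi => hzc i (hk i hi), fun i hi => hz i hi.1⟩)
  exact mem_maxMultSet_of_complementary heM (fun i hi => hz.le hi) fun i hi => hz.1 i hi

theorem critCone_of_tendsto {yss : ℕ → V →ₗ[ℝ] ℝ} {u : V} {us : ℕ → V}
    (hu : Tendsto us atTop (𝓝 u)) {e : ι → ℝ}
    {es : ℕ → ι → ℝ} (he : ∀ i, Tendsto (fun k => es k i) atTop (𝓝 (e i)))
    (heM : e ∈ MultSet A I ys) (hes : ∀ k, es k ∈ MultSet A I (yss k))
    (h : ∀ k, us k ∈ CritCone A I (yss k)) : u ∈ CritCone A I ys := by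
  have hA : ∀ i, Tendsto (fun k => A i (us k)) atTop (𝓝 (A i u)) := fun i =>
    ((A i).continuous_of_finiteDimensional.tendsto u).comp hu
  refine ⟨fun i hi => le_of_tendsto' (hA i) fun k => (h k).1 i hi, ?_⟩
  have h1 : Tendsto (fun k => ∑ i, es k i * A i (us k)) atTop (𝓝 (∑ i, e i * A i u)) :=
    tendsto_finsetSum _ fun i _ => (he i).mul (hA i)
  simp only [fun k => (hes k).2.2 (us k), fun k => (h k).2, heM.2.2 u] at h1
  exact tendsto_nhds_unique h1 tendsto_const_nhds

omit [FiniteDimensional ℝ V] in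
/-- The extremal directions in `PolarData` can be taken bounded and bounded away from zero. -/
theorem PolarData.normalize {Ip : Set ι} {z₀ : V} {α : Finset ι → ℝ} {e : Finset ι → ι → ℝ}
    {u : Finset ι → V} (h : PolarData A I ys B ws w vt Ip z₀ α e u) :
    ∃ u', PolarData A I ys B ws w vt Ip z₀ α e u' ∧ (∀ S, ‖u' S‖ ≤ 1 + ‖vt‖) ∧
      ∀ S, α S ≠ 0 → vt = 0 → ‖u' S‖ = 1 := by
  classical
  by_cases hvt : vt = 0
  · let u' : Finset ι → V := fun S => if α S = 0 then 0 else ‖u S‖⁻¹ • u S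
    have hu' : ∀ S, α S ≠ 0 → u' S = ‖u S‖⁻¹ • u S := fun S hS => by simp [u', hS]
    have hn : ∀ S, α S ≠ 0 → ‖u' S‖ = 1 := fun S hS => by
      rw [hu' S hS, norm_smul, norm_inv, norm_norm,
        inv_mul_cancel₀ (norm_ne_zero_iff.2 (h.extremal S hS).2.2.2.2.2.1)]
    refine ⟨u', { h with extremal := fun S hS => ?_ }, fun S => ?_, fun S hS _ => hn S hS⟩
    · obtain ⟨h1, h2, h3, h4, h5, h6⟩ := h.extremal S hS
      refine ⟨?_, h2, h3, h4, ?_, norm_ne_zero_iff.1 (by rw [hn S hS]; exact one_ne_zero),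
        fun h' => absurd hvt h'⟩
      · rw [hu' S hS]
        exact mem_dirMultSet_smul h1 _
      · rw [hu' S hS]
        refine ⟨fun i hi => ?_, by rw [map_smul, h5.2, smul_zero]⟩
        rw [map_smul, smul_eq_mul]
        exact mul_nonpos_of_nonneg_of_nonpos (by positivity) (h5.1 i hi)
    · by_cases hS : α S = 0
      · simp only [u', hS, if_true, norm_zero]; positivity
      · rw [hn S hS]; linarith [norm_nonneg vt]
  · refine ⟨fun _ => vt, { h with extremal := fun S hS => ?_ }, fun S => by linarith,
      fun _ _ h' => absurd h' hvt⟩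
    obtain ⟨h1, h2, h3, h4, h5, h6⟩ := h.extremal S hS
    rw [h6.2 hvt] at h1 h5
    exact ⟨h1, h2, h3, h4, h5, hvt, fun _ => rfl⟩

/-- `PolarData` passes to the limit, and the limiting multiplier is compatible with the direction
from which the functionals converge. -/
theorem exists_polarData_of_tendsto (hB : ∀ i, Continuous fun p : V × V => B i p.1 p.2)
    {yss wss : ℕ → V →ₗ[ℝ] ℝ} {wk : ℕ → V} {t : ℕ → ℝ}
    (ht : ∀ k, 0 < t k) (hys : ∀ x, Tendsto (fun k => yss k x) atTop (𝓝 (ys x)))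
    (hvs : ∀ x, Tendsto (fun k => (t k)⁻¹ * (yss k x - ys x)) atTop (𝓝 (vs x)))
    (hws : ∀ x, Tendsto (fun k => wss k x) atTop (𝓝 (ws x))) (hw : Tendsto wk atTop (𝓝 w))
    (h : ∃ᶠ k in atTop, ∃ Ip z₀ α e u, PolarData A I (yss k) B (wss k) (wk k) vt Ip z₀ α e u) :
    ∃ Ip z₀ α e u, PolarData A I ys B ws w vt Ip z₀ α e u ∧
      ∃ μ, MixedSign {i | ∑ S, α S * e S i ≠ 0} Ip μ ∧ ∀ x, ∑ i, μ i * A i x = vs x := by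
  classical
  let J : V → Set ι := fun z => {i | i ∈ I ∧ A i z + B i vt vt = 0}
  -- The discrete part of the data, namely `Ip`, the active set of `z₀` and the support of α, is
  -- made constant along a subsequence.
  have hfr : ∃ T : Set ι × Set ι × Finset (Finset ι), ∃ᶠ k in atTop, ∃ z₀ α e u,
      PolarData A I (yss k) B (wss k) (wk k) vt T.1 z₀ α e u ∧ J z₀ = T.2.1 ∧
        ∀ S, S ∈ T.2.2 ↔ α S ≠ 0 := by
    by_contra hcon
    have hcon' := fun T => not_frequently.1 fun h => hcon ⟨T, h⟩
    obtain ⟨k, ⟨Ip, z₀, α, e, u, hk⟩, hk'⟩ := (h.and_eventually (eventually_all.2 hcon')).exists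
    exact hk' ⟨Ip, J z₀, Finset.univ.filter fun S => α S ≠ 0⟩
      ⟨z₀, α, e, u, hk, rfl, by simp⟩
  obtain ⟨⟨Ip, J', T⟩, hT⟩ := hfr
  obtain ⟨φ, hφ, hφP⟩ := extraction_of_frequently_atTop hT
  choose z₀s α e u₀ hP₀ hJ hTα using hφP
  choose u hP hub hun using fun k => (hP₀ k).normalize
  let seq : ℕ → (Finset ι → ℝ) × (Finset ι → V) := fun k => (α k, u k)
  have hα1 : ∀ k S, α k S ≤ 1 := fun k S => by
    rw [← (hP k).sum_eq_one]
    exact Finset.single_le_sum (fun S _ => (hP k).nonneg S) (Finset.mem_univ S)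
  have hbd : ∀ k, seq k ∈ Metric.closedBall (0 : (Finset ι → ℝ) × (Finset ι → V)) (1 + ‖vt‖) := by
    intro k
    rw [mem_closedBall_zero_iff, Prod.norm_def, max_le_iff]
    have h0 : (0 : ℝ) ≤ 1 + ‖vt‖ := by positivity
    refine ⟨(pi_norm_le_iff_of_nonneg h0).2 fun S => ?_,
      (pi_norm_le_iff_of_nonneg h0).2 fun S => hub k S⟩
    change ‖α k S‖ ≤ _
    rw [Real.norm_eq_abs, abs_of_nonneg ((hP k).nonneg S)]
    linarith [hα1 k S, norm_nonneg vt]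
  have : ProperSpace V := FiniteDimensional.proper ℝ V
  obtain ⟨⟨α', u'⟩, -, ψ, hψ, hlim⟩ := tendsto_subseq_of_bounded Metric.isBounded_closedBall hbd
  have hφψ : Tendsto (φ ∘ ψ) atTop atTop := hφ.tendsto_atTop.comp hψ.tendsto_atTop
  have hαl : ∀ S, Tendsto (fun k => α (ψ k) S) atTop (𝓝 (α' S)) := fun S =>
    ((continuous_apply S).comp continuous_fst).continuousAt.tendsto.comp hlim
  have hul : ∀ S, Tendsto (fun k => u (ψ k) S) atTop (𝓝 (u' S)) := fun S =>
    ((continuous_apply S).comp continuous_snd).continuousAt.tendsto.comp hlim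
  have hysl : ∀ x, Tendsto (fun k => yss (φ (ψ k)) x) atTop (𝓝 (ys x)) := fun x =>
    (hys x).comp hφψ
  -- No compactness is needed for the multipliers, and the multiplier set may be unbounded: the dual
  -- vectors express each coefficient as a value of the convergent functionals.
  have hel : ∀ S, ∃ e' : ι → ℝ, S ∈ T → ∀ i, Tendsto (fun k => e (ψ k) S i) atTop (𝓝 (e' i)) := by
    intro S
    by_cases hS : S ∈ T
    · have hS' : ∀ k, α k S ≠ 0 := fun k => (hTα k S).1 hS
      choose x hx using ((hP 0).extremal S (hS' 0)).2.1.exists_dual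
      refine ⟨fun i => ys (x i), fun _ i => ?_⟩
      refine (hysl (x i)).congr fun k => ?_
      have h' := (hP (ψ k)).extremal S (hS' (ψ k))
      rw [← h'.1.1.2.2 (x i), hx i _ h'.2.2.1]
    · exact ⟨0, fun h => absurd h hS⟩
  choose e' he' using hel
  have hα'T : ∀ S, α' S ≠ 0 → S ∈ T := by
    intro S hS
    by_contra hcon
    have h0 : ∀ k, α k S = 0 := fun k => by
      by_contra h; exact hcon ((hTα k S).2 h)
    have := hαl S
    simp only [h0] at this
    exact hS (tendsto_nhds_unique this tendsto_const_nhds)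
  have hα'0 : ∀ S, 0 ≤ α' S := fun S => ge_of_tendsto' (hαl S) fun k => (hP (ψ k)).nonneg S
  have hα'1 : ∑ S, α' S = 1 := by
    have h1 : Tendsto (fun k => ∑ S, α (ψ k) S) atTop (𝓝 (∑ S, α' S)) :=
      tendsto_finsetSum _ fun S _ => hαl S
    simp only [fun k => (hP (ψ k)).sum_eq_one] at h1
    exact tendsto_nhds_unique h1 tendsto_const_nhds
  have hne : ∀ k S, S ∈ T → α k S ≠ 0 := fun k S hS => (hTα k S).1 hS
  have heM : ∀ S ∈ T, e' S ∈ MultSet A I ys := fun S hS =>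
    mem_multSet_of_tendsto hysl (he' S hS) fun k => ((hP (ψ k)).extremal S (hne _ S hS)).1.1
  have hprod : ∀ c : ι → ℝ, ∀ cs : ℕ → ι → ℝ, (∀ i, Tendsto (fun k => cs k i) atTop (𝓝 (c i))) →
      Tendsto (fun k => ∑ S, α (ψ k) S * ∑ i, e (ψ k) S i * cs k i) atTop
        (𝓝 (∑ S, α' S * ∑ i, e' S i * c i)) := by
    intro c cs hc
    refine tendsto_finsetSum _ fun S _ => ?_
    by_cases hS : S ∈ T
    · exact (hαl S).mul (tendsto_finsetSum _ fun i _ => (he' S hS i).mul (hc i))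
    · have h0 : ∀ k, α k S = 0 := fun k => by
        by_contra h; exact hS ((hTα k S).2 h)
      have h0' : α' S = 0 := by
        by_contra h; exact hS (hα'T S h)
      simp only [h0, h0', zero_mul]
      exact tendsto_const_nhds
  have hJ0 : {i | i ∈ I ∧ A i (z₀s 0) + B i vt vt = 0} = J' := hJ 0
  have hJk : ∀ k, {i | i ∈ I ∧ A i (z₀s k) + B i vt vt = 0} = J' := hJ
  have hIpJ : Ip ⊆ J' := hJ0 ▸ (hP 0).subset
  have hwl : Tendsto (fun k => wk (φ (ψ k))) atTop (𝓝 w) := hw.comp hφψ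
  have hAl : ∀ i, Tendsto (fun k => A i (wk (φ (ψ k)))) atTop (𝓝 (A i w)) := fun i =>
    ((A i).continuous_of_finiteDimensional.tendsto w).comp hwl
  have hBl : ∀ i x, Tendsto (fun k => B i x (wk (φ (ψ k)))) atTop (𝓝 (B i x w)) := fun i x =>
    ((B i x).continuous_of_finiteDimensional.tendsto w).comp hwl
  have hex' : ∀ S, α' S ≠ 0 → e' S ∈ DirMultSet A I ys B (u' S) ∧ IndepOn A S ∧
      (∀ i, i ∉ S → e' S i = 0) ∧ (S : Set ι) ⊆ Ip ∧ u' S ∈ CritCone A I ys ∧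
      (u' S ≠ 0 ∧ (vt ≠ 0 → u' S = vt)) := by
    intro S hS
    have hST := hα'T S hS
    have hk := fun k => (hP (ψ k)).extremal S (hne _ S hST)
    refine ⟨dirMultSet_of_tendsto hB (hul S) (he' S hST) (heM S hST) fun k => (hk k).1,
      (hk 0).2.1, fun i hi => ?_, (hk 0).2.2.2.1,
      critCone_of_tendsto (hul S) (he' S hST) (heM S hST) (fun k => (hk k).1.1)
        fun k => (hk k).2.2.2.2.1, ?_⟩
    · have := he' S hST i
      simp only [fun k => (hk k).2.2.1 i hi] at this
      exact tendsto_nhds_unique this tendsto_const_nhds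
    · by_cases hvt : vt = 0
      · refine ⟨norm_ne_zero_iff.1 ?_, fun h' => absurd hvt h'⟩
        have h1 := (hul S).norm
        simp only [fun k => hun (ψ k) S (hne _ S hST) hvt] at h1
        rw [tendsto_nhds_unique h1 tendsto_const_nhds]
        exact one_ne_zero
      · have h1 : u' S = vt := by
          have := hul S
          simp only [fun k => (hk k).2.2.2.2.2.2 hvt] at this
          exact tendsto_nhds_unique this tendsto_const_nhds
        exact ⟨h1 ▸ hvt, fun _ => h1⟩
  -- The conditions on `z₀` do not involve k except through its active set, which is constant, so
  -- the first one can be kept and no convergence of the `z₀s` is required.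
  refine ⟨Ip, z₀s 0, α', e', u', ⟨(hP 0).feasible, (hP 0).subset, ?_, ?_, hα'0, hα'1, hex', ?_⟩,
    ?_⟩
  · rw [hJ0]
    have hk : ∀ k, SolvesSystem A 0 Ip J' (wk (φ (ψ k))) := fun k => hJk (ψ k) ▸ (hP (ψ k)).solves
    refine ⟨fun i hi => ?_, fun i hi => ?_⟩
    · have h1 : ∀ k, A i (wk (φ (ψ k))) = 0 := fun k => by simpa using (hk k).1 i hi
      have := hAl i
      simp only [h1] at this
      simpa using tendsto_nhds_unique this tendsto_const_nhds
    · simpa using le_of_tendsto' (hAl i) fun k => by simpa using (hk k).2 i hi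
  · rw [hJ0]
    exact exists_solvesSystem_of_tendsto hIpJ (fun i => hBl i vt)
      (Eventually.of_forall fun k => hJk (ψ k) ▸ (hP (ψ k)).solvesDir)
  · rw [hJ0]
    let f : V →ₗ[ℝ] ℝ := ws + ∑ S, α' S • ∑ i, e' S i • (B i).flip w
    have hf : ∀ x, f x = ws x + ∑ S, α' S * ∑ i, e' S i * B i x w := fun x => by
      simp [f, LinearMap.sum_apply]
    -- The polar multipliers may be unbounded; what passes to the limit is nonpositivity of the
    -- represented functionals on a fixed polyhedral cone.
    obtain ⟨μ, hμ, hμA⟩ := farkas_mixed A f hIpJ (by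
      intro x hx
      rw [hf]
      refine le_of_tendsto' (((hws x).comp hφψ).add
        (hprod (fun i => B i x w) (fun k i => B i x (wk (φ (ψ k)))) fun i => hBl i x)) fun k => ?_
      obtain ⟨μ, hμ, hμA⟩ := (hP (ψ k)).polar
      rw [hJk] at hμ
      have := hμ.sum_mul_nonpos hx
      simp only [Pi.zero_apply, add_zero, hμA] at this
      exact this)
    exact ⟨μ, hμ, fun x => (hμA x).trans (hf x)⟩
  · refine exists_tangent_multiplier (A := A) (I := I) (ys := ys) (t := fun k => t (φ (ψ k)))
      (yss := fun k => yss (φ (ψ k))) (fun k => ht _) (fun x => (hvs x).comp hφψ)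
      (lams := fun k i => ∑ S, α (ψ k) S * e (ψ k) S i)
      (convexComb_mem_multSet hα'0 hα'1 fun S hS => (hex' S hS).1.1)
      (fun k => convexComb_mem_multSet (hP (ψ k)).nonneg (hP (ψ k)).sum_eq_one fun S hS =>
        ((hP (ψ k)).extremal S hS).1.1) (fun i hi => ?_) fun k i hi => ?_
    · obtain ⟨S, -, hS⟩ := Finset.exists_ne_zero_of_sum_ne_zero hi
      have h' := hex' S (left_ne_zero_of_mul hS)
      refine h'.2.2.2.1 (show i ∈ S from ?_)
      by_contra hcon
      exact hS (by rw [h'.2.2.1 i hcon, mul_zero])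
    · obtain ⟨S, -, hS⟩ := Finset.exists_ne_zero_of_sum_ne_zero hi
      have h' := (hP (ψ k)).extremal S (left_ne_zero_of_mul hS)
      refine h'.2.2.2.1 (show i ∈ S from ?_)
      by_contra hcon
      exact hS (by rw [h'.2.2.1 i hcon, mul_zero])

omit [FiniteDimensional ℝ V] in
/-- The degenerate case in which the approximating critical cones are trivial. -/
theorem exists_polarData_of_critCone_trivial {yss : ℕ → V →ₗ[ℝ] ℝ} {t : ℕ → ℝ}
    (ht : ∀ k, 0 < t k)
    (hvs : ∀ x, Tendsto (fun k => (t k)⁻¹ * (yss k x - ys x)) atTop (𝓝 (vs x)))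
    (hne : (MultSet A I ys).Nonempty) (hnes : ∀ k, (MultSet A I (yss k)).Nonempty)
    {u₀ : V} (hu₀ : u₀ ∈ CritCone A I ys) (hu₀0 : u₀ ≠ 0)
    (h3 : ∃ z, ∀ i ∈ I, A i z + B i u₀ u₀ ≤ 0)
    (h : ∃ᶠ k in atTop, ∀ u ∈ CritCone A I (yss k), u = 0) :
    ∃ Ip z₀ α e u, PolarData A I ys B ws 0 0 Ip z₀ α e u ∧
      ∃ μ, MixedSign {i | ∑ S, α S * e S i ≠ 0} Ip μ ∧ ∀ x, ∑ i, μ i * A i x = vs x := by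
  classical
  obtain ⟨e, he, hei⟩ := exists_basic_maximizer hne h3
  choose lams hlams using hnes
  -- Including both supports serves two ends: the support of e must lie in `Ip`, and `lams k` must
  -- be supported there for the tangent multiplier.
  let R : ℕ → Set ι := fun k => {i | e i ≠ 0} ∪ {i | lams k i ≠ 0}
  have hfr : ∃ Ip, ∃ᶠ k in atTop, (∀ u ∈ CritCone A I (yss k), u = 0) ∧ R k = Ip := by
    by_contra hcon
    have hcon' := fun T => not_frequently.1 fun h => hcon ⟨T, h⟩
    obtain ⟨k, hk, hk'⟩ := (h.and_eventually (eventually_all.2 hcon')).exists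
    exact hk' (R k) ⟨hk, rfl⟩
  obtain ⟨Ip, hIp⟩ := hfr
  obtain ⟨φ, hφ, hφP⟩ := extraction_of_frequently_atTop hIp
  have hR : ∀ k, {i | e i ≠ 0} ∪ {i | lams (φ k) i ≠ 0} = Ip := fun k => (hφP k).2
  have hIpI : Ip ⊆ I := by
    rw [← hR 0]
    rintro i (hi | hi)
    · by_contra h'; exact hi (he.1.2.1 i h')
    · by_contra h'; exact hi ((hlams _).2.1 i h')
  have hJ : {i | i ∈ I ∧ A i 0 + B i 0 0 = 0} = I := by ext i; simp
  -- The cone cut out by `Ip` lies in a trivial critical cone, so its polar is the whole dual space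
  -- and `ws` is unrestricted.
  have hK : ∀ x, SolvesSystem A 0 Ip I x → x = 0 := fun x hx =>
    (hφP 0).1 x (MultSet.mem_critCone (hlams (φ 0)) (fun i hi => by simpa using hx.le hi)
      fun i hi => by simpa using hx.1 i (hR 0 ▸ Or.inr hi))
  let S : Finset ι := Finset.univ.filter fun i => e i ≠ 0
  have hS : (S : Set ι) = {i | e i ≠ 0} := by ext i; simp [S]
  have hsum : ∀ i, ∑ S', (if S' = S then (1 : ℝ) else 0) * e i = e i := by
    intro i; simp
  refine ⟨Ip, 0, fun S' => if S' = S then 1 else 0, fun _ => e, fun _ => u₀,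
    ⟨by simp, by rw [hJ]; exact hIpI, ⟨by simp, by simp⟩, ⟨0, by simp, by simp⟩, ?_, by simp, ?_,
      ?_⟩, ?_⟩
  · intro S'
    split_ifs <;> norm_num
  · intro S' hS'
    have : S' = S := by by_contra h'; exact hS' (if_neg h')
    subst this
    refine ⟨he, hS ▸ hei, fun i hi => ?_, ?_, hu₀, hu₀0, fun h => absurd rfl h⟩
    · by_contra h'; exact hi (by simpa [S] using h')
    · rw [hS, ← hR 0]; exact Set.subset_union_left
  · rw [hJ]
    obtain ⟨μ, hμ, hμA⟩ := farkas_mixed A ws hIpI fun x hx => by rw [hK x hx, map_zero]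
    exact ⟨μ, hμ, fun x => by simp [hμA]⟩
  · simp only [hsum]
    refine exists_tangent_multiplier (A := A) (I := I) (ys := ys) (t := fun k => t (φ k))
      (yss := fun k => yss (φ k)) (fun k => ht _) (fun x => (hvs x).comp hφ.tendsto_atTop)
      (lams := fun k => lams (φ k)) he.1 (fun k => hlams _) (fun i hi => ?_) fun k i hi => ?_
    · rw [← hR 0]; exact Or.inl hi
    · rw [← hR k]; exact Or.inr hi

end PolarLimits


/-! ### Hessians and second-order Taylor expansion. -/

section SecondOrder

variable {E : Type*} [NormedAddCommGroup E] [InnerProductSpace ℝ E] [CompleteSpace E]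

theorem inner_gradient_eq_fderiv (f : E → ℝ) (x v : E) :
    inner ℝ (gradient f x) v = fderiv ℝ f x v := by
  simp [gradient, InnerProductSpace.toDual_symm_apply]

theorem contDiff_gradient {f : E → ℝ} (hf : ContDiff ℝ 2 f) : ContDiff ℝ 1 (gradient f) := by
  have h : ContDiff ℝ 1 (fderiv ℝ f) := hf.fderiv_right (by norm_num)
  exact (InnerProductSpace.toDual ℝ E).symm.toContinuousLinearEquiv.contDiff.comp h

theorem hasFDerivAt_gradient {f : E → ℝ} (hf : ContDiff ℝ 2 f) (x : E) :
    HasFDerivAt (gradient f) (hess f x) x :=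
  ((contDiff_gradient hf).differentiable (by norm_num) x).hasFDerivAt

/-- Links the derivative of the gradient with the second Fréchet derivative, from which symmetry is
inherited. -/
theorem inner_hess_eq {f : E → ℝ} (hf : ContDiff ℝ 2 f) (x v w : E) :
    inner ℝ v (hess f x w) = fderiv ℝ (fderiv ℝ f) x w v := by
  have h1 : HasFDerivAt (fun y => inner ℝ v (gradient f y))
      ((innerSL ℝ v).comp (hess f x)) x :=
    (innerSL ℝ v).hasFDerivAt.comp x (hasFDerivAt_gradient hf x)
  have h : ContDiff ℝ 1 (fderiv ℝ f) := hf.fderiv_right (by norm_num)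
  have h2 : HasFDerivAt (fun y => fderiv ℝ f y v)
      ((ContinuousLinearMap.apply ℝ ℝ v).comp (fderiv ℝ (fderiv ℝ f) x)) x :=
    (ContinuousLinearMap.apply ℝ ℝ v).hasFDerivAt.comp x
      (h.differentiable (by norm_num) x).hasFDerivAt
  have heq : (fun y => inner ℝ v (gradient f y)) = fun y => fderiv ℝ f y v := by
    funext y
    rw [real_inner_comm, inner_gradient_eq_fderiv]
  rw [heq] at h1
  exact congrArg (fun L => L w) (h1.unique h2)

theorem inner_hess_comm {f : E → ℝ} (hf : ContDiff ℝ 2 f) (x v w : E) :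
    inner ℝ v (hess f x w) = inner ℝ w (hess f x v) := by
  rw [inner_hess_eq hf, inner_hess_eq hf]
  exact (hf.contDiffAt.isSymmSndFDerivAt (by simp)) w v

/-- Second-order Taylor expansion with a small-o remainder. -/
theorem taylor_two {f : E → ℝ} (hf : ContDiff ℝ 2 f) (x : E) {ε : ℝ} (hε : 0 < ε) :
    ∃ δ > 0, ∀ d, ‖d‖ ≤ δ →
      |f (x + d) - f x - fderiv ℝ f x d - 2⁻¹ * inner ℝ d (hess f x d)| ≤ ε * ‖d‖ ^ 2 := by
  have hlit := (hasFDerivAt_iff_isLittleO_nhds_zero.1 (hasFDerivAt_gradient hf x)).def hε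
  obtain ⟨δ, hδ, hball⟩ := Metric.eventually_nhds_iff.1 hlit
  refine ⟨δ / 2, by positivity, fun d hd => ?_⟩
  -- The derivative of the second-order remainder is the first-order remainder of the gradient, at
  -- most ε‖d‖ on the ball of radius ‖d‖; the mean value inequality finishes.
  let g : E → ℝ := fun d => f (x + d) - f x - fderiv ℝ f x d - 2⁻¹ * inner ℝ d (hess f x d)
  let g' : E → E →L[ℝ] ℝ := fun d =>
    innerSL ℝ (gradient f (x + d) - gradient f x - hess f x d)
  have hg : ∀ d, HasFDerivAt g (g' d) d := by
    intro d
    have h1 : HasFDerivAt (fun d => f (x + d)) (fderiv ℝ f (x + d)) d := by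
      have := ((hf.differentiable (by norm_num)) (x + d)).hasFDerivAt.comp d
        ((hasFDerivAt_id d).const_add x)
      rw [ContinuousLinearMap.comp_id] at this
      exact this
    have h2 : HasFDerivAt (fun d => inner ℝ d (hess f x d)) _ d :=
      (hasFDerivAt_id d).inner ℝ (hess f x).hasFDerivAt
    have h3 := ((h1.sub_const (f x)).sub (fderiv ℝ f x).hasFDerivAt).sub (h2.const_mul 2⁻¹)
    refine h3.congr_fderiv ?_
    ext h
    simp only [g', innerSL_apply_apply, inner_sub_left, inner_gradient_eq_fderiv]
    simp
    rw [inner_hess_comm hf x d h, real_inner_comm h]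
    ring
  have hbound : ∀ d' ∈ Metric.closedBall (0 : E) ‖d‖, ‖g' d'‖ ≤ ε * ‖d‖ := by
    intro d' hd'
    rw [mem_closedBall_zero_iff] at hd'
    have : dist d' 0 < δ := by
      rw [dist_zero_right]; linarith
    simp only [g', innerSL_apply_norm]
    exact (hball this).trans (mul_le_mul_of_nonneg_left hd' hε.le)
  have := (convex_closedBall (0 : E) ‖d‖).norm_image_sub_le_of_norm_hasFDerivWithin_le
    (fun y _ => (hg y).hasFDerivWithinAt) hbound
    (Metric.mem_closedBall_self (norm_nonneg d)) (show d ∈ Metric.closedBall (0 : E) ‖d‖ by simp)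
  have h0 : g 0 = 0 := by simp [g]
  rw [h0, sub_zero, sub_zero, Real.norm_eq_abs] at this
  calc _ ≤ _ := this
    _ = _ := by ring

end SecondOrder

/-! ### Derivatives of the constraints as linear functionals and bilinear forms. -/

section Lagrangian

variable {m l : ℕ} {q : Eu m → Eu l}

theorem contDiff_component (hq : ContDiff ℝ 2 q) (i : Fin l) : ContDiff ℝ 2 fun x => q x i :=
  (EuclideanSpace.proj i : Eu l →L[ℝ] ℝ).contDiff.comp hq

theorem contDiff_lagrangian (hq : ContDiff ℝ 2 q) (lam : Fin l → ℝ) :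
    ContDiff ℝ 2 fun x => ∑ i, lam i * q x i :=
  ContDiff.sum fun i _ => contDiff_const.mul (contDiff_component hq i)

theorem fderiv_component (hq : ContDiff ℝ 2 q) (i : Fin l) (y v : Eu m) :
    fderiv ℝ (fun x => q x i) y v = dq q y i v := by
  have h : HasFDerivAt (fun x => q x i) ((EuclideanSpace.proj i : Eu l →L[ℝ] ℝ).comp
      (fderiv ℝ q y)) y :=
    (EuclideanSpace.proj i : Eu l →L[ℝ] ℝ).hasFDerivAt.comp y
      (hq.differentiable (by norm_num) y).hasFDerivAt
  rw [h.fderiv]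
  rfl

theorem fderiv_lagrangian (hq : ContDiff ℝ 2 q) (lam : Fin l → ℝ) (y v : Eu m) :
    fderiv ℝ (fun x => ∑ i, lam i * q x i) y v = ∑ i, lam i * dq q y i v := by
  have h : HasFDerivAt (fun x => ∑ i, lam i * q x i)
      (∑ i, lam i • fderiv ℝ (fun x => q x i) y) y :=
    HasFDerivAt.fun_sum fun i _ =>
      (((contDiff_component hq i).differentiable (by norm_num) y).hasFDerivAt).const_mul (lam i)
  rw [h.fderiv, _root_.sum_apply]
  simp only [_root_.smul_apply, smul_eq_mul, fderiv_component hq]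

theorem hessLag_apply (hq : ContDiff ℝ 2 q) (lam : Eu l) (y w : Eu m) :
    hessLag q lam y w = ∑ i, lam i • hess (fun x => q x i) y w := by
  have hgrad : gradient (fun x => ∑ i, lam i * q x i) =
      fun x => ∑ i, lam i • gradient (fun x => q x i) x := by
    funext x
    refine ext_inner_right ℝ fun v => ?_
    simp only [inner_gradient_eq_fderiv, fderiv_lagrangian hq, sum_inner, real_inner_smul_left,
      fderiv_component hq]
  have h : HasFDerivAt (fun x => ∑ i, lam i • gradient (fun x => q x i) x)
      (∑ i, lam i • hess (fun x => q x i) y) y :=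
    HasFDerivAt.fun_sum fun i _ =>
      (hasFDerivAt_gradient (contDiff_component hq i) y).const_smul (lam i)
  rw [hessLag, hess, hgrad, h.fderiv, _root_.sum_apply]
  rfl

theorem inner_hessLag (hq : ContDiff ℝ 2 q) (lam : Eu l) (y v w : Eu m) :
    inner ℝ v (hessLag q lam y w) = ∑ i, lam i * d2q q y i v w := by
  rw [hessLag_apply hq, inner_sum]
  simp only [real_inner_smul_right, d2q]

/-- `∇q_i(y)` as a linear functional. -/
noncomputable def dqLin (q : Eu m → Eu l) (y : Eu m) (i : Fin l) : Eu m →ₗ[ℝ] ℝ :=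
  (EuclideanSpace.proj i : Eu l →L[ℝ] ℝ).toLinearMap ∘ₗ (fderiv ℝ q y).toLinearMap

/-- `∇²q_i(y)` as a bilinear form. -/
noncomputable def d2qLin (q : Eu m → Eu l) (y : Eu m) (i : Fin l) : Eu m →ₗ[ℝ] Eu m →ₗ[ℝ] ℝ :=
  LinearMap.mk₂ ℝ (d2q q y i) (fun _ _ _ => inner_add_left _ _ _)
    (fun _ _ _ => real_inner_smul_left _ _ _)
    (fun _ _ _ => by simp only [d2q, map_add, inner_add_right])
    fun _ _ _ => by simp only [d2q, map_smul, real_inner_smul_right, smul_eq_mul]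

@[simp] theorem dqLin_apply (y : Eu m) (i : Fin l) (v : Eu m) : dqLin q y i v = dq q y i v := rfl

@[simp] theorem d2qLin_apply (y : Eu m) (i : Fin l) (v w : Eu m) :
    d2qLin q y i v w = d2q q y i v w := rfl

theorem continuous_d2qLin (y : Eu m) (i : Fin l) :
    Continuous fun p : Eu m × Eu m => d2qLin q y i p.1 p.2 := by
  simp only [d2qLin_apply, d2q]
  fun_prop

theorem inner_dqT (y : Eu m) (μ : Eu l) (x : Eu m) :
    inner ℝ (dqT q y μ) x = ∑ i, μ i * dq q y i x := by
  rw [dqT, ContinuousLinearMap.adjoint_inner_left, PiLp.inner_apply]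
  exact Finset.sum_congr rfl fun i _ => by simp [dq, mul_comm]

theorem dqT_eq_iff (y : Eu m) (μ : Eu l) (a : Eu m) :
    dqT q y μ = a ↔ ∀ x, ∑ i, μ i * dq q y i x = inner ℝ a x := by
  constructor
  · rintro rfl x
    exact (inner_dqT y μ x).symm
  · intro h
    exact ext_inner_right ℝ fun x => (inner_dqT y μ x).trans (h x)

/-- The functional `x ↦ ⟨a, x⟩`. -/
noncomputable def innerLin (a : Eu m) : Eu m →ₗ[ℝ] ℝ := (innerSL ℝ a).toLinearMap

@[simp] theorem innerLin_apply (a x : Eu m) : innerLin a x = inner ℝ a x := rfl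

end Lagrangian


/-! ### Regular normals: polarity and minimizers. -/

section NormalCones

variable {E : Type*} [NormedAddCommGroup E] [InnerProductSpace ℝ E]

/-- A regular normal has nonpositive inner product with every direction along which the set can be
approximated to first order. -/
theorem inner_nonpos_of_mem_regNormalCone {Ω : Set E} {z n d : E} (hn : n ∈ regNormalCone Ω z)
    (h : ∀ ε : ℝ, 0 < ε → ∀ᶠ s : ℝ in 𝓝[>] 0, ∃ p ∈ Ω, ‖p - (z + s • d)‖ ≤ ε * s) :
    inner ℝ n d ≤ 0 := by
  have key : ∀ ε : ℝ, 0 < ε → ε ≤ 1 → inner ℝ n d ≤ ε * (‖n‖ + ‖d‖ + 1) := by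
    intro ε hε hε1
    have h1 := hn.2 ε hε
    rw [eventually_nhdsWithin_iff, Metric.eventually_nhds_iff] at h1
    obtain ⟨δ, hδ, h1⟩ := h1
    have h2 : ∀ᶠ s : ℝ in 𝓝[>] 0, s * (‖d‖ + 1) < δ := by
      have : Tendsto (fun s : ℝ => s * (‖d‖ + 1)) (𝓝[>] 0) (𝓝 (0 * (‖d‖ + 1))) :=
        ((continuous_id.mul continuous_const).tendsto 0).mono_left nhdsWithin_le_nhds
      rw [zero_mul] at this
      exact this.eventually (gt_mem_nhds hδ)
    obtain ⟨s, ⟨⟨p, hp, hps⟩, hsδ⟩, hs⟩ :=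
      (((h ε hε).and h2).and (self_mem_nhdsWithin : Set.Ioi (0 : ℝ) ∈ 𝓝[>] 0)).exists
    have hs : 0 < s := hs
    have e1 : p - z = s • d + (p - (z + s • d)) := by abel
    have e2 : ‖p - z‖ ≤ s * (‖d‖ + ε) := by
      rw [e1]
      refine (norm_add_le _ _).trans ?_
      rw [norm_smul, Real.norm_eq_abs, abs_of_pos hs]
      linarith
    have e3 := h1 (y := p) (by
      rw [dist_eq_norm]
      refine lt_of_le_of_lt (e2.trans ?_) hsδ
      gcongr) hp
    have e4 : inner ℝ n (p - z) = s * inner ℝ n d + inner ℝ n (p - (z + s • d)) := by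
      conv_lhs => rw [e1]
      rw [inner_add_right, real_inner_smul_right]
    have e5 : -(‖n‖ * (ε * s)) ≤ inner ℝ n (p - (z + s • d)) := by
      have := (abs_le.1 (abs_real_inner_le_norm n (p - (z + s • d)))).1
      have h6 := mul_le_mul_of_nonneg_left hps (norm_nonneg n)
      linarith
    have e6 : s * inner ℝ n d ≤ s * (ε * (‖n‖ + ‖d‖ + 1)) := by
      have h7 := mul_le_mul_of_nonneg_left e2 hε.le
      have h8 : ε * (s * (‖d‖ + ε)) ≤ ε * (s * (‖d‖ + 1)) := by gcongr
      nlinarith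
    exact le_of_mul_le_mul_left e6 hs
  by_contra hcon
  push Not at hcon
  have hC : 0 < ‖n‖ + ‖d‖ + 1 := by positivity
  set C := ‖n‖ + ‖d‖ + 1
  have h1 := key (min 1 (inner ℝ n d / (2 * C))) (by positivity) (min_le_left _ _)
  have h2 : min 1 (inner ℝ n d / (2 * C)) * C ≤ inner ℝ n d / (2 * C) * C := by
    gcongr
    exact min_le_right _ _
  have h3 : inner ℝ n d / (2 * C) * C = inner ℝ n d / 2 := by field_simp
  linarith

/-- Optimality condition for minimizing a linear-quadratic function over a set. -/
theorem mem_regNormalCone_of_minimizer {Ω : Set E} {x₀ y p ybar : E} {c δ : ℝ}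
    (hy : y ∈ Ω) (hyδ : ‖y - ybar‖ < δ)
    (hmin : ∀ y' ∈ Ω, ‖y' - ybar‖ ≤ δ →
      -inner ℝ p (y - ybar) + c / 2 * ‖y - x₀‖ ^ 2 ≤
        -inner ℝ p (y' - ybar) + c / 2 * ‖y' - x₀‖ ^ 2) :
    p - c • (y - x₀) ∈ regNormalCone Ω y := by
  refine ⟨hy, fun ε hε => ?_⟩
  have h1 : ∀ᶠ y' in 𝓝 y, ‖y' - ybar‖ < δ :=
    (((continuous_id.sub continuous_const).norm).tendsto y).eventually (gt_mem_nhds hyδ)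
  have h2 : ∀ᶠ y' in 𝓝 y, c / 2 * ‖y' - y‖ < ε := by
    have : Tendsto (fun y' => c / 2 * ‖y' - y‖) (𝓝 y) (𝓝 (c / 2 * ‖y - y‖)) :=
      (continuous_const.mul (continuous_id.sub continuous_const).norm).tendsto y
    rw [sub_self, norm_zero, mul_zero] at this
    exact this.eventually (gt_mem_nhds hε)
  -- The candidate is the negative gradient of the objective at y. Minimality leaves only the
  -- quadratic term c/2 ‖y' - y‖², which is o(‖y' - y‖).
  filter_upwards [nhdsWithin_le_nhds h1, nhdsWithin_le_nhds h2, self_mem_nhdsWithin]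
    with y' hy1 hy2 hy'
  have h3 := hmin y' hy' hy1.le
  have e1 : y' - x₀ = (y - x₀) + (y' - y) := by abel
  have e2 : ‖y' - x₀‖ ^ 2 = ‖y - x₀‖ ^ 2 + 2 * inner ℝ (y - x₀) (y' - y) + ‖y' - y‖ ^ 2 := by
    rw [e1, norm_add_sq_real]
  have e3 : y' - ybar = (y - ybar) + (y' - y) := by abel
  rw [e2, e3, inner_add_right] at h3
  rw [inner_sub_left, real_inner_smul_left]
  have h4 := mul_le_mul_of_nonneg_right hy2.le (norm_nonneg (y' - y))
  nlinarith

end NormalCones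

/-! ### Feasible curves from metric subregularity. -/

section Constraints

variable {m l : ℕ} {q : Eu m → Eu l} {ybar : Eu m}

theorem isClosed_feasibleSet (hq : Continuous q) : IsClosed (feasibleSet q) := by
  simp only [feasibleSet, Set.ofPred_forall]
  exact isClosed_iInter fun i => isClosed_le
    ((EuclideanSpace.proj i : Eu l →L[ℝ] ℝ).continuous.comp hq) continuous_const

/-- Error bound furnished by metric subregularity of the perturbation mapping. -/
theorem exists_error_bound (hsub : MetricallySubregularAt (perturbMap q) ybar 0) :
    ∃ κ > 0, ∀ᶠ x in 𝓝 ybar, ∀ r > 0, (∀ i, q x i ≤ r) → ∃ p ∈ feasibleSet q, ‖p - x‖ ≤ κ * r := by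
  obtain ⟨-, κ, hκ, U, hU, h⟩ := hsub
  -- The factor √l compares the Euclidean norm of the positive part of q with its largest entry; the
  -- extra 1 makes the distance bound strict, so some feasible point realizes it.
  refine ⟨κ * (√l + 1), by positivity, ?_⟩
  filter_upwards [hU] with x hx r hr hqr
  have hfeas : {x' | (0 : Eu l) ∈ perturbMap q x'} = feasibleSet q := by
    ext x'
    constructor
    · rintro ⟨p, hp, hpx⟩ i
      have : q x' = p := sub_eq_zero.1 hpx
      rw [this]; exact hp i
    · intro hx'
      exact ⟨q x', hx', sub_self _⟩
  have h1 := h x hx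
  rw [hfeas] at h1
  let p : Eu l := WithLp.toLp 2 fun i => min (q x i) 0
  have hp : q x - p ∈ perturbMap q x := ⟨p, fun i => min_le_right _ _, rfl⟩
  have hnorm : ‖q x - p‖ ≤ √l * r := by
    rw [EuclideanSpace.norm_eq]
    have : ∑ i, ‖(q x - p) i‖ ^ 2 ≤ ∑ _i : Fin l, r ^ 2 := by
      refine Finset.sum_le_sum fun i _ => ?_
      have e1 : (q x - p) i = q x i - min (q x i) 0 := rfl
      rw [e1, Real.norm_eq_abs, sq_abs]
      rcases le_total (q x i) 0 with h0 | h0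
      · rw [min_eq_left h0, sub_self]; simpa using sq_nonneg r
      · rw [min_eq_right h0, sub_zero]
        exact pow_le_pow_left₀ h0 (hqr i) 2
    calc √(∑ i, ‖(q x - p) i‖ ^ 2) ≤ √(∑ _i : Fin l, r ^ 2) := Real.sqrt_le_sqrt this
      _ = √l * r := by
        rw [Finset.sum_const, Finset.card_univ, Fintype.card_fin, nsmul_eq_mul,
          Real.sqrt_mul (Nat.cast_nonneg l), Real.sqrt_sq hr.le]
  have h2 : Metric.infEDist (0 : Eu l) (perturbMap q x) ≤ ENNReal.ofReal (√l * r) := by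
    refine (Metric.infEDist_le_edist_of_mem hp).trans ?_
    rw [edist_dist, dist_zero_left]
    exact ENNReal.ofReal_le_ofReal hnorm
  have h3 : Metric.infEDist x (feasibleSet q) < ENNReal.ofReal (κ * (√l + 1) * r) := by
    calc _ ≤ ENNReal.ofReal κ * ENNReal.ofReal (√l * r) := h1.trans (by gcongr)
      _ = ENNReal.ofReal (κ * (√l * r)) := (ENNReal.ofReal_mul hκ.le).symm
      _ < _ := by
        rw [ENNReal.ofReal_lt_ofReal_iff (by positivity)]
        nlinarith [mul_pos hκ hr]
  obtain ⟨y, hy, hyx⟩ := Metric.infEDist_lt_iff.1 h3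
  refine ⟨y, hy, ?_⟩
  rw [edist_dist, ENNReal.ofReal_lt_ofReal_iff (by positivity)] at hyx
  rw [← dist_eq_norm, dist_comm]
  exact hyx.le

/-- A curve violating the constraints by a small amount can be corrected to a feasible one. -/
theorem eventually_exists_feasible (hsub : MetricallySubregularAt (perturbMap q) ybar 0)
    {x : ℝ → Eu m} (hx : Tendsto x (𝓝[>] 0) (𝓝 ybar)) {ρ : ℝ → ℝ} (hρ : ∀ s, 0 < s → 0 < ρ s)
    (h : ∀ η : ℝ, 0 < η → ∀ i, ∀ᶠ s in 𝓝[>] 0, q (x s) i ≤ η * ρ s) {ε : ℝ} (hε : 0 < ε) :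
    ∀ᶠ s in 𝓝[>] 0, ∃ p ∈ feasibleSet q, ‖p - x s‖ ≤ ε * ρ s := by
  obtain ⟨κ, hκ, hb⟩ := exists_error_bound hsub
  filter_upwards [hx.eventually hb, eventually_all.2 (h (ε / κ) (by positivity)),
    self_mem_nhdsWithin] with s hs1 hs2 hs
  have := hρ s hs
  obtain ⟨p, hp, hpx⟩ := hs1 (ε / κ * ρ s) (by positivity) hs2
  refine ⟨p, hp, hpx.trans (le_of_eq ?_)⟩
  field_simp

theorem tendsto_second_order_curve (y v z : Eu m) :
    Tendsto (fun s : ℝ => y + (s • v + (s ^ 2 / 2) • z)) (𝓝[>] 0) (𝓝 y) := by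
  have hc : Continuous fun s : ℝ => y + (s • v + (s ^ 2 / 2) • z) := by fun_prop
  have := (hc.tendsto 0).mono_left (nhdsWithin_le_nhds (s := Set.Ioi (0 : ℝ)))
  simpa using this

/-- Second-order expansion of a constraint along a parabolic arc. -/
theorem eventually_component_le (hq : ContDiff ℝ 2 q) (i : Fin l) (v z : Eu m) {η : ℝ}
    (hη : 0 < η) : ∀ᶠ s : ℝ in 𝓝[>] 0, q (ybar + (s • v + (s ^ 2 / 2) • z)) i ≤
      q ybar i + s * dq q ybar i v + s ^ 2 / 2 * (dq q ybar i z + d2q q ybar i v v) +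
        η * s ^ 2 := by
  set ε := η / (2 * (‖v‖ ^ 2 + 1)) with hε
  have hεpos : 0 < ε := by positivity
  obtain ⟨δ, hδ, hT⟩ := taylor_two (contDiff_component hq i) ybar hεpos
  have hsmall : ∀ᶠ s : ℝ in 𝓝[>] 0, ‖s • v + (s ^ 2 / 2) • z‖ < δ := by
    have := (tendsto_second_order_curve 0 v z).norm
    simp only [zero_add, norm_zero] at this
    exact this.eventually (gt_mem_nhds hδ)
  -- This is the quadratic part and the remainder bound along the arc, divided by s². It is
  -- continuous at s = 0, and ε was chosen so that ε‖v‖² < η.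
  let r : ℝ → ℝ := fun s => 2⁻¹ * d2q q ybar i (v + (s / 2) • z) (v + (s / 2) • z) +
    ε * ‖v + (s / 2) • z‖ ^ 2
  have hr : ∀ᶠ s : ℝ in 𝓝[>] 0, r s < 2⁻¹ * d2q q ybar i v v + η := by
    have hc : Continuous r := by
      simp only [r, d2q]
      fun_prop
    have h1 := (hc.tendsto 0).mono_left (nhdsWithin_le_nhds (s := Set.Ioi (0 : ℝ)))
    refine h1.eventually (gt_mem_nhds ?_)
    simp only [r, zero_div, zero_smul, add_zero, add_lt_add_iff_left]
    rw [hε, div_mul_eq_mul_div, div_lt_iff₀ (by positivity)]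
    nlinarith [sq_nonneg ‖v‖]
  filter_upwards [hsmall, hr, self_mem_nhdsWithin] with s hs1 hs2 hs
  have hs : 0 < s := hs
  have h1 := (abs_le.1 (hT _ hs1.le)).2
  have e1 : s • v + (s ^ 2 / 2) • z = s • (v + (s / 2) • z) := by
    rw [smul_add, smul_smul]; ring_nf
  have e2 : fderiv ℝ (fun x => q x i) ybar (s • v + (s ^ 2 / 2) • z) =
      s * dq q ybar i v + s ^ 2 / 2 * dq q ybar i z := by
    rw [map_add, map_smul, map_smul, fderiv_component hq, fderiv_component hq, smul_eq_mul,
      smul_eq_mul]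
  have e3 : 2⁻¹ * inner ℝ (s • v + (s ^ 2 / 2) • z)
      (hess (fun x => q x i) ybar (s • v + (s ^ 2 / 2) • z)) +
      ε * ‖s • v + (s ^ 2 / 2) • z‖ ^ 2 = s ^ 2 * r s := by
    rw [e1, map_smul, real_inner_smul_left, real_inner_smul_right, norm_smul, mul_pow,
      Real.norm_eq_abs, sq_abs]
    simp only [r, d2q]
    ring
  have h4 := mul_le_mul_of_nonneg_left hs2.le (sq_nonneg s)
  rw [e2] at h1
  nlinarith

theorem eventually_inactive_nonpos (hq : ContDiff ℝ 2 q) (hy : ybar ∈ feasibleSet q) {i : Fin l}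
    (hi : i ∉ active q ybar) {x : ℝ → Eu m} (hx : Tendsto x (𝓝[>] 0) (𝓝 ybar)) :
    ∀ᶠ s in 𝓝[>] 0, q (x s) i ≤ 0 := by
  have h1 : q ybar i < 0 := lt_of_le_of_ne (hy i) hi
  have h2 : Tendsto (fun s => q (x s) i) (𝓝[>] 0) (𝓝 (q ybar i)) :=
    ((contDiff_component hq i).continuous.tendsto ybar).comp hx
  exact (h2.eventually (gt_mem_nhds h1)).mono fun s hs => hs.le

theorem eventually_exists_feasible_second_order (hq : ContDiff ℝ 2 q) (hy : ybar ∈ feasibleSet q)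
    (hsub : MetricallySubregularAt (perturbMap q) ybar 0) {v z : Eu m}
    (hv : ∀ i ∈ active q ybar, dq q ybar i v ≤ 0)
    (hz : ∀ i ∈ active q ybar, dq q ybar i z + d2q q ybar i v v ≤ 0) {ε : ℝ} (hε : 0 < ε) :
    ∀ᶠ s : ℝ in 𝓝[>] 0, ∃ p ∈ feasibleSet q,
      ‖p - (ybar + (s • v + (s ^ 2 / 2) • z))‖ ≤ ε * s ^ 2 := by
  refine eventually_exists_feasible hsub (tendsto_second_order_curve ybar v z)
    (fun s hs => by positivity) (fun η hη i => ?_) hε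
  by_cases hi : i ∈ active q ybar
  · filter_upwards [eventually_component_le (ybar := ybar) hq i v z hη, self_mem_nhdsWithin] with s hs1 hs
    have h0 : q ybar i = 0 := hi
    have h2 := mul_nonpos_of_nonneg_of_nonpos (le_of_lt hs) (hv i hi)
    have h3 := mul_nonpos_of_nonneg_of_nonpos (show (0 : ℝ) ≤ s ^ 2 / 2 by positivity) (hz i hi)
    linarith
  · filter_upwards [eventually_inactive_nonpos hq hy hi (tendsto_second_order_curve ybar v z)]
      with s hs
    exact hs.trans (by positivity)

theorem eventually_exists_feasible_first_order (hq : ContDiff ℝ 2 q) (hy : ybar ∈ feasibleSet q)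
    (hsub : MetricallySubregularAt (perturbMap q) ybar 0) {v : Eu m}
    (hv : ∀ i ∈ active q ybar, dq q ybar i v ≤ 0) {ε : ℝ} (hε : 0 < ε) :
    ∀ᶠ s : ℝ in 𝓝[>] 0, ∃ p ∈ feasibleSet q, ‖p - (ybar + s • v)‖ ≤ ε * s := by
  have hx : Tendsto (fun s : ℝ => ybar + s • v) (𝓝[>] 0) (𝓝 ybar) := by
    simpa using tendsto_second_order_curve ybar v 0
  refine eventually_exists_feasible hsub hx (fun s hs => hs) (fun η hη i => ?_) hε
  by_cases hi : i ∈ active q ybar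
  · have hsm : ∀ᶠ s : ℝ in 𝓝[>] 0, s * (2⁻¹ * d2q q ybar i v v + 1) < η := by
      have hc : Continuous fun s : ℝ => s * (2⁻¹ * d2q q ybar i v v + 1) := by fun_prop
      refine ((hc.tendsto 0).mono_left nhdsWithin_le_nhds).eventually (gt_mem_nhds ?_)
      simpa using hη
    filter_upwards [eventually_component_le (ybar := ybar) hq i v 0 one_pos, hsm,
      self_mem_nhdsWithin] with s hs1 hs2 hs
    have hs : 0 < s := hs
    have h0 : q ybar i = 0 := hi
    have h00 : dq q ybar i 0 = 0 := (dqLin q ybar i).map_zero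
    have h2 := mul_nonpos_of_nonneg_of_nonpos hs.le (hv i hi)
    have h3 := mul_le_mul_of_nonneg_left hs2.le hs.le
    simp only [smul_zero, add_zero] at hs1
    rw [h0, h00] at hs1
    nlinarith
  · filter_upwards [eventually_inactive_nonpos hq hy hi hx, self_mem_nhdsWithin] with s hs hs0
    have hs0 : 0 < s := hs0
    exact hs.trans (by positivity)

end Constraints


/-! ### Tangent directions and regular normals of the graph of the normal cone mapping. -/

section Graph

variable {m l : ℕ} {q : Eu m → Eu l} {ybar ystar : Eu m}

/-- Subregularity acts as a constraint qualification: rays in the linearized cone are corrected to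
feasible points with error o(s). -/
theorem mem_tangentCone_feasibleSet_iff (hq : ContDiff ℝ 2 q) (hy : ybar ∈ feasibleSet q)
    (hsub : MetricallySubregularAt (perturbMap q) ybar 0) {v : Eu m} :
    v ∈ tangentCone (feasibleSet q) ybar ↔ ∀ i ∈ active q ybar, dq q ybar i v ≤ 0 := by
  constructor
  · rintro ⟨t, us, ht, ht0, hus, hmem⟩ i hi
    have h1 : HasFDerivAt (fun x => q x i) (fderiv ℝ (fun x => q x i) ybar) ybar :=
      ((contDiff_component hq i).differentiable (by norm_num) ybar).hasFDerivAt
    have h4 : Tendsto (fun k => (t k)⁻¹ • (t k • us k)) atTop (𝓝 v) := by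
      refine hus.congr fun k => ?_
      rw [smul_smul, inv_mul_cancel₀ (ht k).ne', one_smul]
    have h5 : Tendsto (fun k => t k • us k) atTop (𝓝 0) := by
      simpa using ht0.smul hus
    have h6 := (hasFDerivWithinAt_univ.2 h1).lim h5 (.of_forall fun _ => Set.mem_univ _) h4
    rw [fderiv_component hq] at h6
    refine le_of_tendsto' h6 fun k => ?_
    have h7 : q ybar i = 0 := hi
    rw [h7, sub_zero, smul_eq_mul]
    exact mul_nonpos_of_nonneg_of_nonpos (inv_pos.2 (ht k)).le (hmem k i)
  · intro hv
    have hex : ∀ n : ℕ, ∃ s : ℝ, (0 < s ∧ s < 1 / ((n : ℝ) + 1)) ∧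
        ∃ p ∈ feasibleSet q, ‖p - (ybar + s • v)‖ ≤ 1 / ((n : ℝ) + 1) * s := by
      intro n
      have hn : (0 : ℝ) < 1 / ((n : ℝ) + 1) := by positivity
      obtain ⟨s, hs, hs'⟩ := ((eventually_exists_feasible_first_order hq hy hsub hv hn).and
        (Ioo_mem_nhdsGT hn)).exists
      exact ⟨s, hs', hs⟩
    choose s hs p hp hps using hex
    have h0 : Tendsto (fun n : ℕ => 1 / ((n : ℝ) + 1)) atTop (𝓝 0) :=
      tendsto_one_div_add_atTop_nhds_zero_nat
    refine ⟨s, fun n => (s n)⁻¹ • (p n - ybar), fun n => (hs n).1,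
      squeeze_zero (fun n => (hs n).1.le) (fun n => (hs n).2.le) h0, ?_, fun n => ?_⟩
    · rw [tendsto_iff_norm_sub_tendsto_zero]
      refine squeeze_zero (fun n => norm_nonneg _) (fun n => ?_) h0
      have hsn := (hs n).1
      have e1 : (s n)⁻¹ • (p n - ybar) - v = (s n)⁻¹ • (p n - (ybar + s n • v)) := by
        rw [← sub_sub, smul_sub _ (p n - ybar), smul_smul, inv_mul_cancel₀ hsn.ne', one_smul]
      rw [e1, norm_smul, norm_inv, Real.norm_eq_abs, abs_of_pos hsn,
        inv_mul_le_iff₀ hsn, mul_comm]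
      exact hps n
    · rw [smul_smul, mul_inv_cancel₀ (hs n).1.ne', one_smul, add_sub_cancel]
      exact hp n

theorem multSet_nonempty_of_mem_regNormalCone (hq : ContDiff ℝ 2 q)
    (hsub : MetricallySubregularAt (perturbMap q) ybar 0)
    (h : ystar ∈ regNormalCone (feasibleSet q) ybar) :
    (MultSet (dqLin q ybar) (active q ybar) (innerLin ystar)).Nonempty := by
  obtain ⟨μ, hμ, hA⟩ := farkas_mixed (dqLin q ybar) (innerLin ystar)
    (Set.empty_subset (active q ybar)) fun x hx =>
      inner_nonpos_of_mem_regNormalCone h fun ε hε =>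
        eventually_exists_feasible_first_order hq h.1 hsub (fun i hi => by simpa using hx.le hi) hε
  exact ⟨μ, hμ.mem_multSet hA⟩

/-- On the feasible set the function λᵀq is nonpositive and it vanishes at `ybar`, so the functional
`ystar`, its derivative there, is at most o(‖y' - `ybar`‖). -/
theorem mem_regNormalCone_of_mem_multSet (hq : ContDiff ℝ 2 q) (hy : ybar ∈ feasibleSet q)
    {lam : Fin l → ℝ} (h : lam ∈ MultSet (dqLin q ybar) (active q ybar) (innerLin ystar)) :
    ystar ∈ regNormalCone (feasibleSet q) ybar := by
  refine ⟨hy, fun ε hε => ?_⟩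
  have h1 : HasFDerivAt (fun x => ∑ i, lam i * q x i) _ ybar :=
    ((contDiff_lagrangian hq lam).differentiable (by norm_num) ybar).hasFDerivAt
  filter_upwards [nhdsWithin_le_nhds (h1.isLittleO.def hε), self_mem_nhdsWithin] with y' hy1 hy'
  rw [fderiv_lagrangian hq] at hy1
  have e1 : ∑ i, lam i * dq q ybar i (y' - ybar) = inner ℝ ystar (y' - ybar) := h.2.2 _
  have e2 : ∑ i, lam i * q ybar i = 0 := Finset.sum_eq_zero fun i _ => by
    by_cases hi : i ∈ active q ybar
    · rw [show q ybar i = 0 from hi, mul_zero]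
    · rw [h.2.1 i hi, zero_mul]
  have e3 : ∑ i, lam i * q y' i ≤ 0 := Finset.sum_nonpos fun i _ =>
    mul_nonpos_of_nonneg_of_nonpos (h.1 i) (hy' i)
  rw [e1, e2, Real.norm_eq_abs] at hy1
  linarith [(abs_le.1 hy1).1]

/-- Feasibility of the dual linear program in every direction tangent to the feasible set. -/
theorem exists_dual_feasible (hq : ContDiff ℝ 2 q) (hy : ybar ∈ feasibleSet q)
    (hsub : MetricallySubregularAt (perturbMap q) ybar 0) {v : Eu m}
    (hv : ∀ i ∈ active q ybar, dq q ybar i v ≤ 0) :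
    ∃ z, ∀ i ∈ active q ybar, dqLin q ybar i z + d2qLin q ybar i v v ≤ 0 := by
  rcases system_alternative (dqLin q ybar) (fun i => d2qLin q ybar i v v)
    (Set.empty_subset (active q ybar)) with ⟨z, hz⟩ | ⟨δ, hδ, hA, hpos⟩
  · exact ⟨z, fun i hi => hz.le hi⟩
  exfalso
  -- An infeasibility certificate is a multiplier δ ≥ 0 for the zero functional with positive
  -- curvature in direction v. Then δᵀq would be positive of order s² at feasible points near `ybar`
  -- + s v, although δᵀq ≤ 0 there.
  have hδM : δ ∈ MultSet (dqLin q ybar) (active q ybar) (0 : Eu m →ₗ[ℝ] ℝ) :=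
    hδ.mem_multSet (by simpa using hA)
  set H := hessLag q (WithLp.toLp 2 δ) ybar with hH
  have hb : 0 < inner ℝ v (H v) := by
    rw [hH, inner_hessLag hq]
    exact hpos
  set b := inner ℝ v (H v)
  set η := b / (4 * (‖v‖ ^ 2 + 1)) with hη
  have hηpos : 0 < η := by positivity
  obtain ⟨r, hr, hT⟩ := taylor_two (contDiff_lagrangian hq δ) ybar hηpos
  have hβ : Continuous fun x : Eu m => 2⁻¹ * inner ℝ x (H x) - η * ‖x‖ ^ 2 := by fun_prop
  have hβv : 0 < 2⁻¹ * inner ℝ v (H v) - η * ‖v‖ ^ 2 := by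
    have : η * ‖v‖ ^ 2 < 2⁻¹ * b := by
      rw [hη, div_mul_eq_mul_div, div_lt_iff₀ (by positivity)]
      nlinarith [sq_nonneg ‖v‖]
    linarith
  obtain ⟨ε, hε, hball⟩ := Metric.eventually_nhds_iff.1
    ((hβ.tendsto v).eventually (lt_mem_nhds hβv))
  have hsmall : ∀ᶠ s : ℝ in 𝓝[>] 0, s * (‖v‖ + ε) < r := by
    have hc : Continuous fun s : ℝ => s * (‖v‖ + ε) := by fun_prop
    refine ((hc.tendsto 0).mono_left nhdsWithin_le_nhds).eventually (gt_mem_nhds ?_)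
    simpa using hr
  obtain ⟨s, ⟨⟨p, hp, hps⟩, hsr⟩, hs⟩ :=
    (((eventually_exists_feasible_first_order hq hy hsub hv (half_pos hε)).and hsmall).and
      (self_mem_nhdsWithin : Set.Ioi (0 : ℝ) ∈ 𝓝[>] 0)).exists
  have hs : 0 < s := hs
  set x := s⁻¹ • (p - ybar) with hx
  have hpx : p = ybar + s • x := by
    rw [hx, smul_smul, mul_inv_cancel₀ hs.ne', one_smul, add_sub_cancel]
  have hxv : ‖x - v‖ ≤ ε / 2 := by
    have e1 : p - (ybar + s • v) = s • (x - v) := by rw [hpx, smul_sub]; abel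
    rw [e1, norm_smul, Real.norm_eq_abs, abs_of_pos hs, mul_comm] at hps
    exact le_of_mul_le_mul_right hps hs
  have hβx := hball (y := x) (by rw [dist_eq_norm]; linarith)
  have hxn : ‖s • x‖ ≤ r := by
    rw [norm_smul, Real.norm_eq_abs, abs_of_pos hs]
    have : ‖x‖ ≤ ‖v‖ + ε := by
      have := norm_add_le v (x - v)
      rw [add_sub_cancel] at this
      linarith
    exact (mul_le_mul_of_nonneg_left this hs.le).trans hsr.le
  have h1 := (abs_le.1 (hT _ hxn)).1
  rw [← hpx, fderiv_lagrangian hq] at h1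
  have e1 : ∑ i, δ i * dq q ybar i (s • x) = 0 := hA _
  have e2 : ∑ i, δ i * q ybar i = 0 := Finset.sum_eq_zero fun i _ => by
    by_cases hi : i ∈ active q ybar
    · rw [show q ybar i = 0 from hi, mul_zero]
    · rw [hδM.2.1 i hi, zero_mul]
  have e3 : ∑ i, δ i * q p i ≤ 0 := Finset.sum_nonpos fun i _ =>
    mul_nonpos_of_nonneg_of_nonpos (hδM.1 i) (hp i)
  have e4 : inner ℝ (s • x) (hess (fun x => ∑ i, δ i * q x i) ybar (s • x)) =
      s ^ 2 * inner ℝ x (H x) := by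
    rw [map_smul, real_inner_smul_left, real_inner_smul_right]
    simp only [hH, hessLag]
    ring
  have e5 : ‖s • x‖ ^ 2 = s ^ 2 * ‖x‖ ^ 2 := by
    rw [norm_smul, mul_pow, Real.norm_eq_abs, sq_abs]
  rw [e1, e2, e4, e5] at h1
  have := mul_pos (pow_pos hs 2) hβx
  nlinarith

set_option maxHeartbeats 1000000 in
/-- Tangent directions `(v, ∇²(λᵀq)(ybar) v)` to the graph of the regular normal cone mapping. -/
theorem eventually_exists_gphNormal (hq : ContDiff ℝ 2 q) (hy : ybar ∈ feasibleSet q)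
    (hsub : MetricallySubregularAt (perturbMap q) ybar 0) {lam : Fin l → ℝ} {v z : Eu m}
    (hlam : lam ∈ MultSet (dqLin q ybar) (active q ybar) (innerLin ystar))
    (hv : v ∈ CritCone (dqLin q ybar) (active q ybar) (innerLin ystar))
    (hz : ∀ i ∈ active q ybar, dqLin q ybar i z + d2qLin q ybar i v v ≤ 0)
    (hc : ∀ i, lam i ≠ 0 → dqLin q ybar i z + d2qLin q ybar i v v = 0) {ε : ℝ} (hε : 0 < ε) :
    ∀ᶠ s : ℝ in 𝓝[>] 0, ∃ p ∈ gphNormal q, ‖p - (pair ybar ystar +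
      s • pair v (hessLag q (WithLp.toLp 2 lam) ybar v))‖ ≤ ε * s := by
  set H := hessLag q (WithLp.toLp 2 lam) ybar with hH
  have hHsymm : ∀ a b : Eu m, inner ℝ a (H b) = inner ℝ b (H a) := fun a b =>
    inner_hess_comm (contDiff_lagrangian hq lam) ybar a b
  have hyv : inner ℝ ystar v = 0 := hv.2
  have hyz : inner ℝ ystar z = -inner ℝ v (H v) := by
    have h1 : ∑ i, lam i * (dq q ybar i z + d2q q ybar i v v) = 0 :=
      Finset.sum_eq_zero fun i _ => by
        by_cases hi : lam i = 0
        · rw [hi, zero_mul]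
        · have := hc i hi
          simp only [dqLin_apply, d2qLin_apply] at this
          rw [this, mul_zero]
    simp only [mul_add, Finset.sum_add_distrib] at h1
    have h2 : ∑ i, lam i * dq q ybar i z = inner ℝ ystar z := hlam.2.2 z
    rw [hH, inner_hessLag hq, ← h2]
    linarith
  -- With c = ‖H‖ + 2 the form ⟨x, Hx⟩ + c‖x‖² is at least 2‖x‖². The factor 1 + c in ε' pays for
  -- the final error (x, -c x); η is small enough to absorb half the coercivity and give 2Cη ≤ ε'².
  set c : ℝ := ‖H‖ + 2 with hcdef
  have hc0 : 0 < c := by positivity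
  set ε' := ε / (1 + c) with hε'
  have hε'0 : 0 < ε' := by positivity
  set C : ℝ := 2 * ‖v‖ ^ 2 + ‖ystar‖ + 1 with hC
  have hC0 : 0 < C := by positivity
  obtain ⟨η, hη0, hη1, hηC⟩ : ∃ η : ℝ, 0 < η ∧ η ≤ 1 / 4 ∧ 2 * C * η ≤ ε' ^ 2 := by
    refine ⟨min (1 / 4) (ε' ^ 2 / (2 * C)), by positivity, min_le_left _ _, ?_⟩
    have := min_le_right (1 / 4) (ε' ^ 2 / (2 * C))
    rw [le_div_iff₀ (by positivity)] at this
    linarith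
  obtain ⟨δ, hδ, hT⟩ := taylor_two (contDiff_lagrangian hq lam) ybar hη0
  set M : ℝ := ‖z‖ + 1 with hM
  have hM0 : 0 < M := by positivity
  have hsm1 : ∀ᶠ s : ℝ in 𝓝[>] 0, s * (‖H v‖ * M) + c / 2 * s ^ 2 * M ^ 2 < η := by
    have hcont : Continuous fun s : ℝ => s * (‖H v‖ * M) + c / 2 * s ^ 2 * M ^ 2 := by fun_prop
    refine ((hcont.tendsto 0).mono_left nhdsWithin_le_nhds).eventually (gt_mem_nhds ?_)
    simpa using hη0
  have hsm2 : ∀ᶠ s : ℝ in 𝓝[>] 0, s * (‖v‖ + ε') < δ := by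
    have hcont : Continuous fun s : ℝ => s * (‖v‖ + ε') := by fun_prop
    refine ((hcont.tendsto 0).mono_left nhdsWithin_le_nhds).eventually (gt_mem_nhds ?_)
    simpa using hδ
  have hsm3 : ∀ᶠ s : ℝ in 𝓝[>] 0, s * ‖v‖ + s ^ 2 * M < δ := by
    have hcont : Continuous fun s : ℝ => s * ‖v‖ + s ^ 2 * M := by fun_prop
    refine ((hcont.tendsto 0).mono_left nhdsWithin_le_nhds).eventually (gt_mem_nhds ?_)
    simpa using hδ
  filter_upwards [eventually_exists_feasible_second_order hq hy hsub hv.1 hz hη0, hsm1, hsm2,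
    hsm3, self_mem_nhdsWithin] with s hps hs1 hs2 hs3 hs
  have hs : 0 < s := hs
  obtain ⟨p, hp, hpn⟩ := hps
  set ρ := p - (ybar + (s • v + (s ^ 2 / 2) • z)) with hρ
  set x₀ := ybar + s • v with hx₀
  have hpx₀ : p - x₀ = (s ^ 2 / 2) • z + ρ := by rw [hρ, hx₀]; abel
  have hpx₀n : ‖p - x₀‖ ≤ s ^ 2 * M := by
    rw [hpx₀]
    refine (norm_add_le _ _).trans ?_
    rw [norm_smul, Real.norm_eq_abs, abs_of_nonneg (by positivity)]
    nlinarith [norm_nonneg z, sq_nonneg s, mul_nonneg (sq_nonneg s) (norm_nonneg z),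
      mul_le_mul_of_nonneg_right hη1 (sq_nonneg s)]
  have hpy : p - ybar = s • v + (p - x₀) := by rw [hx₀]; abel
  have hpδ : ‖p - ybar‖ ≤ δ := by
    rw [hpy]
    refine (norm_add_le _ _).trans ?_
    rw [norm_smul, Real.norm_eq_abs, abs_of_pos hs]
    linarith
  set a := ystar + s • H v with ha
  -- The desired graph point is produced by minimizing φ over feasible points near `ybar`: an
  -- interior minimizer y carries the normal a - c(y - x₀). It remains to show that y - x₀ is o(s).
  let φ : Eu m → ℝ := fun y => -inner ℝ a (y - ybar) + c / 2 * ‖y - x₀‖ ^ 2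
  have hφc : Continuous φ := by
    simp only [φ]
    fun_prop
  have hcomp : IsCompact (feasibleSet q ∩ Metric.closedBall ybar δ) :=
    (isCompact_closedBall ybar δ).inter_left (isClosed_feasibleSet hq.continuous)
  obtain ⟨y, ⟨hyΓ, hyb⟩, hymin⟩ := hcomp.exists_isMinOn
    ⟨p, hp, by rwa [Metric.mem_closedBall, dist_eq_norm]⟩ hφc.continuousOn
  rw [Metric.mem_closedBall, dist_eq_norm] at hyb
  have hmin : ∀ y' ∈ feasibleSet q, ‖y' - ybar‖ ≤ δ → φ y ≤ φ y' := fun y' hy' hb =>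
    hymin ⟨hy', by rwa [Metric.mem_closedBall, dist_eq_norm]⟩
  set x := y - x₀ with hx
  have hyd : y - ybar = s • v + x := by rw [hx, hx₀]; abel
  -- The competitor p follows the parabolic arc with acceleration z. Complementarity gives ⟨`ystar`,
  -- z⟩ = -⟨v, Hv⟩, which fixes the value to second order.
  have hupper : φ p ≤ -(2⁻¹ * s ^ 2 * inner ℝ v (H v)) + s ^ 2 * η * (‖ystar‖ + 1) := by
    have e1 : φ p = -(inner ℝ ystar (p - ybar)) - s * inner ℝ (H v) (p - ybar) +
        c / 2 * ‖p - x₀‖ ^ 2 := by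
      simp only [φ, ha, inner_add_left, real_inner_smul_left]
      ring
    have e2 : inner ℝ ystar (p - ybar) = -(s ^ 2 / 2 * inner ℝ v (H v)) + inner ℝ ystar ρ := by
      rw [hpy, hpx₀, inner_add_right, inner_add_right, real_inner_smul_right,
        real_inner_smul_right, hyv, hyz]
      ring
    have e3 : inner ℝ (H v) (p - ybar) = s * inner ℝ v (H v) + inner ℝ (H v) (p - x₀) := by
      rw [hpy, inner_add_right, real_inner_smul_right, real_inner_comm]
    have e4 : -(‖ystar‖ * (η * s ^ 2)) ≤ inner ℝ ystar ρ := by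
      have h1 := (abs_le.1 (abs_real_inner_le_norm ystar ρ)).1
      have h2 := mul_le_mul_of_nonneg_left hpn (norm_nonneg ystar)
      linarith
    have e5 : -(‖H v‖ * (s ^ 2 * M)) ≤ inner ℝ (H v) (p - x₀) := by
      have h1 := (abs_le.1 (abs_real_inner_le_norm (H v) (p - x₀))).1
      have h2 := mul_le_mul_of_nonneg_left hpx₀n (norm_nonneg (H v))
      linarith
    have e6 : ‖p - x₀‖ ^ 2 ≤ (s ^ 2 * M) ^ 2 := pow_le_pow_left₀ (norm_nonneg _) hpx₀n 2
    have e7 := mul_le_mul_of_nonneg_left e6 (show 0 ≤ c / 2 by positivity)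
    have e8 := mul_le_mul_of_nonneg_left e5 hs.le
    have e9 := mul_le_mul_of_nonneg_left hs1.le (sq_nonneg s)
    rw [e1, e2, e3]
    linarith
  -- Since λᵀq ≤ 0 at y, its Taylor expansion bounds -⟨`ystar`, y - `ybar`⟩ from below by the
  -- quadratic term. The terms mixed in v and x then cancel by symmetry of H, and the leading term
  -- matches that of the upper bound.
  have hlower : 2⁻¹ * (inner ℝ x (H x) + c * ‖x‖ ^ 2) - 2⁻¹ * s ^ 2 * inner ℝ v (H v) -
      η * ‖y - ybar‖ ^ 2 ≤ φ y := by
    have h1 := (abs_le.1 (hT (y - ybar) hyb)).1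
    rw [add_sub_cancel, fderiv_lagrangian hq] at h1
    have e1 : ∑ i, lam i * dq q ybar i (y - ybar) = inner ℝ ystar (y - ybar) := hlam.2.2 _
    have e2 : ∑ i, lam i * q ybar i = 0 := Finset.sum_eq_zero fun i _ => by
      by_cases hi : i ∈ active q ybar
      · rw [show q ybar i = 0 from hi, mul_zero]
      · rw [hlam.2.1 i hi, zero_mul]
    have e3 : ∑ i, lam i * q y i ≤ 0 := Finset.sum_nonpos fun i _ =>
      mul_nonpos_of_nonneg_of_nonpos (hlam.1 i) (hyΓ i)
    have e4 : hess (fun x => ∑ i, lam i * q x i) ybar = H := rfl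
    rw [e1, e2, e4] at h1
    have e5 : inner ℝ (y - ybar) (H (y - ybar)) = s ^ 2 * inner ℝ v (H v) +
        2 * s * inner ℝ x (H v) + inner ℝ x (H x) := by
      rw [hyd, map_add, map_smul, inner_add_left, inner_add_right, inner_add_right,
        real_inner_smul_left, real_inner_smul_left, real_inner_smul_right,
        real_inner_smul_right, hHsymm v x]
      ring
    have e6 : φ y = -(inner ℝ ystar (y - ybar)) - s * inner ℝ (H v) (y - ybar) +
        c / 2 * ‖x‖ ^ 2 := by
      simp only [φ, ha, inner_add_left, real_inner_smul_left]
      ring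
    have e7 : inner ℝ (H v) (y - ybar) = s * inner ℝ v (H v) + inner ℝ x (H v) := by
      rw [hyd, inner_add_right, real_inner_smul_right, real_inner_comm, real_inner_comm x]
    rw [e6, e7]
    rw [e5] at h1
    linarith
  have hxx : -(‖H‖ * ‖x‖ ^ 2) ≤ inner ℝ x (H x) := by
    have h1 := (abs_le.1 (abs_real_inner_le_norm x (H x))).1
    have h2 := mul_le_mul_of_nonneg_left (H.le_opNorm x) (norm_nonneg x)
    linarith
  have hyn : ‖y - ybar‖ ^ 2 ≤ 2 * (s ^ 2 * ‖v‖ ^ 2) + 2 * ‖x‖ ^ 2 := by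
    have h1 : ‖y - ybar‖ ≤ s * ‖v‖ + ‖x‖ := by
      rw [hyd]
      refine (norm_add_le _ _).trans ?_
      rw [norm_smul, Real.norm_eq_abs, abs_of_pos hs]
    have h2 := pow_le_pow_left₀ (norm_nonneg _) h1 2
    nlinarith [sq_nonneg (s * ‖v‖ - ‖x‖)]
  have hφφ := hmin p hp hpδ
  have hx2 : ‖x‖ ^ 2 ≤ (ε' * s) ^ 2 := by
    have h1 := mul_le_mul_of_nonneg_left hyn hη0.le
    have h2 := mul_le_mul_of_nonneg_right hη1 (sq_nonneg ‖x‖)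
    have h3 := mul_le_mul_of_nonneg_right hηC (sq_nonneg s)
    have h4 : 2⁻¹ * ‖x‖ ^ 2 ≤ η * s ^ 2 * C := by
      have hcX : c * ‖x‖ ^ 2 = ‖H‖ * ‖x‖ ^ 2 + 2 * ‖x‖ ^ 2 := by rw [hcdef]; ring
      rw [hC]
      linarith
    rw [mul_pow]
    linarith
  have hxn : ‖x‖ ≤ ε' * s := by
    exact (sq_le_sq₀ (norm_nonneg _) (by positivity)).1 hx2
  have hyδ : ‖y - ybar‖ < δ := by
    rw [hyd]
    refine lt_of_le_of_lt (norm_add_le _ _) ?_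
    rw [norm_smul, Real.norm_eq_abs, abs_of_pos hs]
    linarith
  refine ⟨pair y (a - c • x), mem_regNormalCone_of_minimizer hyΓ hyδ hmin, ?_⟩
  have e1 : pair y (a - c • x) - (pair ybar ystar + s • pair v (H v)) = pair x (-(c • x)) := by
    have h1 : y - (ybar + s • v) = x := rfl
    have h2 : a - c • x - (ystar + s • H v) = -(c • x) := by rw [ha]; abel
    rw [← h1] at h2 ⊢
    rw [← h2]
    rfl
  have e2 : pair x (-(c • x)) = pair x 0 + pair 0 (-(c • x)) := by
    simp [pair, ← WithLp.toLp_add]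
  rw [e1, e2]
  refine (norm_add_le _ _).trans ?_
  have e3 : ‖pair x 0‖ = ‖x‖ := WithLp.norm_toLp_fst 2 _ _ x
  have e4 : ‖pair 0 (-(c • x))‖ = ‖-(c • x)‖ := WithLp.norm_toLp_snd 2 _ _ _
  rw [e3, e4, norm_neg, norm_smul, Real.norm_eq_abs, abs_of_pos hc0]
  calc ‖x‖ + c * ‖x‖ = (1 + c) * ‖x‖ := by ring
    _ ≤ (1 + c) * (ε' * s) := by gcongr
    _ = ε * s := by rw [hε']; field_simp

theorem inner_pair (p : Pair m) (a b : Eu m) :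
    inner ℝ p (pair a b) = inner ℝ p.fst a + inner ℝ p.snd b := by
  rw [WithLp.prod_inner_apply]
  rfl

/-- Polar inequalities for a regular normal to the graph of the regular normal cone mapping. -/
theorem polar_of_mem_regNormalCone_gphNormal (hq : ContDiff ℝ 2 q)
    (hsub : MetricallySubregularAt (perturbMap q) ybar 0) {p : Pair m}
    (hp : p ∈ regNormalCone (gphNormal q) (pair ybar ystar)) :
    ∀ v ∈ CritCone (dqLin q ybar) (active q ybar) (innerLin ystar),
      ∀ lam ∈ DirMultSet (dqLin q ybar) (active q ybar) (innerLin ystar) (d2qLin q ybar) v,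
        innerLin p.fst v + ∑ i, lam i * d2qLin q ybar i v p.snd ≤ 0 := by
  intro v hv lam hlam
  have hy : ybar ∈ feasibleSet q := hp.1.1
  obtain ⟨z, hz, hzc⟩ := MaxMultSet.exists_dual hlam
  have h1 := inner_nonpos_of_mem_regNormalCone hp fun ε hε =>
    eventually_exists_gphNormal hq hy hsub hlam.1 hv hz hzc hε
  rw [inner_pair] at h1
  have h2 : inner ℝ p.snd (hessLag q (WithLp.toLp 2 lam) ybar v) =
      ∑ i, lam i * d2qLin q ybar i v p.snd := by
    have h3 := inner_hess_comm (contDiff_lagrangian hq lam) ybar p.snd v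
    exact h3.trans (inner_hessLag hq (WithLp.toLp 2 lam) ybar v p.snd)
  rw [h2] at h1
  exact h1

/-- With the base point held at `ybar`, the vector `ystar` may move along any active gradient and
along ±`ystar`. Testing the normal on these vertical directions yields the inequalities and the
orthogonality. -/
theorem snd_mem_critCone_of_mem_regNormalCone_gphNormal (hq : ContDiff ℝ 2 q)
    (hsub : MetricallySubregularAt (perturbMap q) ybar 0) {p : Pair m}
    (hp : p ∈ regNormalCone (gphNormal q) (pair ybar ystar)) :
    p.snd ∈ CritCone (dqLin q ybar) (active q ybar) (innerLin ystar) := by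
  classical
  have hy : ybar ∈ feasibleSet q := hp.1.1
  obtain ⟨lam, hlam⟩ : (MultSet (dqLin q ybar) (active q ybar) (innerLin ystar)).Nonempty :=
    multSet_nonempty_of_mem_regNormalCone hq hsub hp.1
  have key : ∀ n : Eu m, (∀ᶠ s : ℝ in 𝓝[>] 0, ∃ lam',
      lam' ∈ MultSet (dqLin q ybar) (active q ybar) (innerLin (ystar + s • n))) →
      inner ℝ p.snd n ≤ 0 := by
    intro n hn
    have h1 := inner_nonpos_of_mem_regNormalCone (d := pair 0 n) hp fun ε hε => by
      filter_upwards [hn, self_mem_nhdsWithin] with s ⟨lam', hlam'⟩ hs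
      have hs : 0 < s := hs
      refine ⟨pair ybar (ystar + s • n), mem_regNormalCone_of_mem_multSet hq hy hlam', ?_⟩
      have : pair ybar (ystar + s • n) = pair ybar ystar + s • pair 0 n := by
        simp [pair, ← WithLp.toLp_smul, ← WithLp.toLp_add]
      rw [this, sub_self, norm_zero]
      positivity
    rw [inner_pair, inner_zero_right, zero_add] at h1
    exact h1
  have hscale : ∀ c : ℝ, 0 ≤ c →
      (fun i => c * lam i) ∈ MultSet (dqLin q ybar) (active q ybar) (innerLin (c • ystar)) := by
    intro c hc
    refine ⟨fun i => mul_nonneg hc (hlam.1 i), fun i hi => by simp [hlam.2.1 i hi],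
      fun x => ?_⟩
    simp only [mul_assoc, ← Finset.mul_sum, hlam.2.2 x, innerLin_apply, real_inner_smul_left]
  refine ⟨fun i hi => ?_, le_antisymm ?_ ?_⟩
  · have h1 := key (gradient (fun x => q x i) ybar) (by
      filter_upwards [self_mem_nhdsWithin] with s hs
      have hs : 0 < s := hs
      refine ⟨fun j => lam j + s * Pi.single (M := fun _ => ℝ) i 1 j, fun j => ?_, fun j hj => ?_, fun x => ?_⟩
      · refine add_nonneg (hlam.1 j) (mul_nonneg hs.le ?_)
        by_cases h : j = i
        · subst h; simp
        · simp [h]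
      · have : j ≠ i := fun h => hj (h ▸ hi)
        simp [hlam.2.1 j hj, this]
      · simp only [add_mul, Finset.sum_add_distrib, hlam.2.2 x, innerLin_apply, inner_add_left,
          real_inner_smul_left, inner_gradient_eq_fderiv, fderiv_component hq]
        simp [Pi.single_apply])
    rw [real_inner_comm, inner_gradient_eq_fderiv, fderiv_component hq] at h1
    exact h1
  · have h1 := key ystar (by
      filter_upwards [self_mem_nhdsWithin] with s hs
      have hs : 0 < s := hs
      exact ⟨_, by simpa [add_smul] using hscale (1 + s) (by linarith)⟩)
    rwa [real_inner_comm] at h1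
  · have h1 := key (-ystar) (by
      filter_upwards [Ioo_mem_nhdsGT one_pos] with s hs
      exact ⟨_, by simpa [sub_smul, ← sub_eq_add_neg] using hscale (1 - s) (by linarith [hs.2])⟩)
    rw [inner_neg_right, real_inner_comm] at h1
    rw [innerLin_apply]
    linarith

end Graph


/-! ### From linear programming data back to the sets of the statement. -/

section Translation

variable {m l : ℕ} {q : Eu m → Eu l} {ybar ystar : Eu m}

theorem mem_convNormalCone_nonposOrthant_iff {y lam : Eu l} (hy : ∀ i, y i ≤ 0) :
    lam ∈ convNormalCone (nonposOrthant l) y ↔ (∀ i, 0 ≤ lam i) ∧ ∀ i, y i ≠ 0 → lam i = 0 := by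
  constructor
  · rintro ⟨-, h⟩
    have h0 : ∀ i, 0 ≤ lam i := by
      intro i
      have h1 := h (y - EuclideanSpace.single i 1) (fun j => by
        by_cases hj : j = i
        · subst hj; simp; linarith [hy j]
        · simp [hj, hy j])
      simp only [sub_sub_cancel_left, inner_neg_right, EuclideanSpace.inner_single_right] at h1
      simpa using h1
    refine ⟨h0, fun i hi => ?_⟩
    have h1 := h (y - EuclideanSpace.single i (y i)) (fun j => by
      by_cases hj : j = i
      · subst hj; simp
      · simp [hj, hy j])
    simp only [sub_sub_cancel_left, inner_neg_right, EuclideanSpace.inner_single_right] at h1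
    have h2 : 0 ≤ y i * lam i := by simpa using h1
    by_contra hne
    have h3 := mul_neg_of_neg_of_pos (lt_of_le_of_ne (hy i) hi) (lt_of_le_of_ne (h0 i) (Ne.symm hne))
    linarith
  · rintro ⟨h0, hc⟩
    refine ⟨hy, fun x hx => ?_⟩
    rw [PiLp.inner_apply]
    refine Finset.sum_nonpos fun i _ => ?_
    have e : inner ℝ (lam i) ((x - y) i) = lam i * (x i - y i) := by simp [mul_comm]
    rw [e]
    by_cases hi : y i = 0
    · rw [hi, sub_zero]
      exact mul_nonpos_of_nonneg_of_nonpos (h0 i) (hx i)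
    · rw [hc i hi, zero_mul]

theorem mem_multipliers_iff (hy : ybar ∈ feasibleSet q) {lam : Eu l} :
    lam ∈ multipliers q ybar ystar ↔
      (fun i => lam i) ∈ MultSet (dqLin q ybar) (active q ybar) (innerLin ystar) := by
  unfold multipliers MultSet
  simp only [Set.mem_ofPred_eq, mem_convNormalCone_nonposOrthant_iff hy, dqT_eq_iff, and_assoc]
  rfl

theorem mem_dirMultipliers_iff (hq : ContDiff ℝ 2 q) (hy : ybar ∈ feasibleSet q) {lam : Eu l}
    {v : Eu m} : lam ∈ dirMultipliers q ybar ystar v ↔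
      (fun i => lam i) ∈ DirMultSet (dqLin q ybar) (active q ybar) (innerLin ystar)
        (d2qLin q ybar) v := by
  simp only [dirMultipliers, DirMultSet, MaxMultSet, Set.mem_ofPred_eq, mem_multipliers_iff hy,
    inner_hessLag hq, d2qLin_apply]
  exact and_congr_right fun _ => ⟨fun h lam' h' => h (WithLp.toLp 2 lam') h', fun h lam' h' =>
    h _ h'⟩

theorem mem_criticalCone_iff (hq : ContDiff ℝ 2 q) (hy : ybar ∈ feasibleSet q)
    (hsub : MetricallySubregularAt (perturbMap q) ybar 0) {v : Eu m} :
    v ∈ criticalCone q ybar ystar ↔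
      v ∈ CritCone (dqLin q ybar) (active q ybar) (innerLin ystar) := by
  simp only [criticalCone, CritCone, Set.mem_ofPred_eq,
    mem_tangentCone_feasibleSet_iff hq hy hsub, dqLin_apply, innerLin_apply]

/-- A multiplier with linearly independent active gradients is an extreme point. -/
theorem mem_extremePoints_of_indepOn (hy : ybar ∈ feasibleSet q) {e : Fin l → ℝ}
    (he : e ∈ MultSet (dqLin q ybar) (active q ybar) (innerLin ystar)) {S : Set (Fin l)}
    (hS : IndepOn (dqLin q ybar) S) (heS : ∀ i, i ∉ S → e i = 0) :
    WithLp.toLp 2 e ∈ (multipliers q ybar ystar).extremePoints ℝ := by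
  refine ⟨(mem_multipliers_iff hy).2 he, fun x hx y hy' hxy => ?_⟩
  obtain ⟨a, b, ha, hb, -, hab⟩ := hxy
  have hx := (mem_multipliers_iff hy).1 hx
  have hy' := (mem_multipliers_iff hy).1 hy'
  -- In a convex decomposition of e, nonnegative terms summing to zero vanish off S, so both
  -- endpoints are supported in S and independence identifies them with e.
  have hxS : ∀ i, i ∉ S → x i = 0 := by
    intro i hi
    have h1 : a * x i + b * y i = e i := congrArg (fun f : Eu l => f i) hab
    rw [heS i hi] at h1
    have h2 := mul_nonneg hb.le (hy'.1 i)
    have h3 := mul_nonneg ha.le (hx.1 i)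
    have h4 : a * x i = 0 := by linarith
    exact (mul_eq_zero.1 h4).resolve_left ha.ne'
  have := hS.eq hxS heS fun z => (hx.2.2 z).trans (he.2.2 z).symm
  ext i
  exact congrFun this i

theorem sum_smul_mem_of_convex {κ F : Type*} [Fintype κ] [AddCommGroup F] [Module ℝ F] {C : Set F}
    (hC : Convex ℝ C) {α : κ → ℝ} (h0 : ∀ S, 0 ≤ α S) (h1 : ∑ S, α S = 1) {x : κ → F}
    (hx : ∀ S, α S ≠ 0 → x S ∈ C) : ∑ S, α S • x S ∈ C := by
  classical
  have e1 : ∑ S ∈ Finset.univ.filter (fun S => α S ≠ 0), α S = 1 := by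
    rw [Finset.sum_filter_ne_zero, h1]
  have e2 : ∑ S ∈ Finset.univ.filter (fun S => α S ≠ 0), α S • x S = ∑ S, α S • x S := by
    refine Finset.sum_filter_of_ne fun S _ h hS => h ?_
    rw [hS, zero_smul]
  rw [← e2]
  exact hC.sum_mem (fun S _ => h0 S) e1 fun S hS => hx S (Finset.mem_filter.1 hS).2

/-- A multiplier direction which is nonnegative at the vanishing components is tangent to the
normal cone of the orthant. -/
theorem mem_tangentCone_convNormalCone {y lam μ : Eu l} (hy : ∀ i, y i ≤ 0)
    (hlam : lam ∈ convNormalCone (nonposOrthant l) y) (hμ0 : ∀ i, y i ≠ 0 → μ i = 0)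
    (hμ : ∀ i, lam i = 0 → 0 ≤ μ i) : μ ∈ tangentCone (convNormalCone (nonposOrthant l) y) lam := by
  rw [mem_convNormalCone_nonposOrthant_iff hy] at hlam
  have hev : ∀ᶠ s : ℝ in 𝓝[>] 0, ∀ i, 0 ≤ lam i + s * μ i := by
    rw [eventually_all]
    intro i
    by_cases hi : lam i = 0
    · filter_upwards [self_mem_nhdsWithin] with s hs
      rw [hi, zero_add]
      exact mul_nonneg (le_of_lt hs) (hμ i hi)
    · have hc : Continuous fun s : ℝ => lam i + s * μ i := by fun_prop
      have hpos : 0 < lam i := lt_of_le_of_ne (hlam.1 i) (Ne.symm hi)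
      exact (((hc.tendsto 0).mono_left nhdsWithin_le_nhds).eventually
        (lt_mem_nhds (by simpa using hpos))).mono fun s hs => hs.le
  have h0 : Tendsto (fun n : ℕ => 1 / ((n : ℝ) + 1)) atTop (𝓝[>] 0) :=
    tendsto_nhdsWithin_iff.2 ⟨tendsto_one_div_add_atTop_nhds_zero_nat,
      Eventually.of_forall fun n => show (0 : ℝ) < _ by positivity⟩
  obtain ⟨N, hN⟩ := eventually_atTop.1 (h0.eventually hev)
  refine ⟨fun k => 1 / (((k + N : ℕ) : ℝ) + 1), fun _ => μ, fun k => by positivity,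
    (tendsto_add_atTop_iff_nat N).2 tendsto_one_div_add_atTop_nhds_zero_nat, tendsto_const_nhds,
    fun k => ?_⟩
  rw [mem_convNormalCone_nonposOrthant_iff hy]
  refine ⟨fun i => hN (k + N) (by omega) i, fun i hi => ?_⟩
  simp [hlam.2 i hi, hμ0 i hi]

/-- The multiplier λ is the weighted sum of the extremal multipliers, and I is taken to be all of J,
the dual active set of `z₀`. -/
theorem exists_QZero_of_polarData (hq : ContDiff ℝ 2 q) (hy : ybar ∈ feasibleSet q)
    (hsub : MetricallySubregularAt (perturbMap q) ybar 0) {vstar v : Eu m}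
    (hv : v ∈ nullSpace q ybar) {p : Pair m} {Ip : Set (Fin l)} {z₀ : Eu m}
    {α : Finset (Fin l) → ℝ} {e : Finset (Fin l) → Fin l → ℝ} {u : Finset (Fin l) → Eu m}
    (h : PolarData (dqLin q ybar) (active q ybar) (innerLin ystar) (d2qLin q ybar)
      (innerLin p.fst) p.snd v Ip z₀ α e u)
    (hμ : ∃ μ, MixedSign {i | ∑ S, α S * e S i ≠ 0} Ip μ ∧
      ∀ x, ∑ i, μ i * dqLin q ybar i x = innerLin vstar x) :
    ∃ lam μ : Eu l, (lam, μ) ∈ multiplierPairs q ybar ystar 0 vstar ∧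
      lam ∈ extDirMultipliersTilde q ybar ystar v ∧
      ∃ J ∈ dualActiveSets q ybar v, ∃ Ip I : Set (Fin l),
        posIdxPair lam μ ⊆ Ip ∧ Ip ⊆ I ∧ I ⊆ J ∧ p ∈ QZero q ybar v lam Ip I := by
  obtain ⟨μ, hμs, hμA⟩ := hμ
  have hJ : dualActive q ybar v z₀ =
      {i | i ∈ active q ybar ∧ dqLin q ybar i z₀ + d2qLin q ybar i v v = 0} := by
    ext i
    exact ⟨fun hi => ⟨hi.1.1, hi.2⟩, fun hi => ⟨⟨hi.1, hv i hi.1⟩, hi.2⟩⟩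
  have hIpI : Ip ⊆ active q ybar := fun i hi => (h.subset hi).1
  have hlamM := convexComb_mem_multSet h.nonneg h.sum_eq_one fun S hS => (h.extremal S hS).1.1
  set lam : Eu l := WithLp.toLp 2 fun i => ∑ S, α S * e S i with hlam
  have hlamS : lam = ∑ S, α S • (WithLp.toLp 2 (e S) : Eu l) := by
    ext i
    simp [hlam]
  have hlam' : lam ∈ multipliers q ybar ystar := (mem_multipliers_iff hy).2 hlamM
  have hext : ∀ S, α S ≠ 0 →
      (WithLp.toLp 2 (e S) : Eu l) ∈ extDirMultipliers q ybar ystar (u S) := fun S hS => by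
    have h1 := h.extremal S hS
    exact ⟨(mem_dirMultipliers_iff hq hy).2 h1.1, subset_convexHull ℝ _
      (mem_extremePoints_of_indepOn hy h1.1.1 h1.2.1 fun i hi => h1.2.2.1 i hi)⟩
  have hsum : ∀ c : Fin l → ℝ, ∑ S, α S * ∑ i, e S i * c i = ∑ i, lam i * c i := by
    intro c
    simp only [hlam, Finset.sum_mul, Finset.mul_sum]
    rw [Finset.sum_comm]
    exact Finset.sum_congr rfl fun S _ => Finset.sum_congr rfl fun i _ => by ring
  have hlamIp : ∀ i, lam i ≠ 0 → i ∈ Ip := by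
    intro i hi
    change ∑ S, α S * e S i ≠ 0 at hi
    obtain ⟨S, -, hS⟩ := Finset.exists_ne_zero_of_sum_ne_zero hi
    have h' := h.extremal S (left_ne_zero_of_mul hS)
    refine h'.2.2.2.1 (show i ∈ S from ?_)
    by_contra hcon
    exact hS (by rw [h'.2.2.1 i hcon, mul_zero])
  refine ⟨lam, WithLp.toLp 2 μ, ⟨?_, ?_, ?_⟩, ?_, dualActive q ybar v z₀, ⟨z₀, h.feasible, rfl⟩,
    Ip, dualActive q ybar v z₀, ?_, hJ ▸ h.subset, le_rfl, ⟨?_, ?_⟩, ?_⟩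
  -- In direction 0 the objective vanishes, so every multiplier is a maximizer.
  · exact ⟨hlam', fun lam' _ => by simp⟩
  · refine mem_tangentCone_convNormalCone hy hlam'.1 (fun i hi => hμs.1 i fun h' => hi (hIpI h'))
      fun i hi => ?_
    by_cases hip : i ∈ Ip
    · exact hμs.2 i ⟨hip, fun h' => h' hi⟩
    · exact (hμs.1 i hip).ge
  · have : dqT q ybar (WithLp.toLp 2 μ) = vstar := (dqT_eq_iff _ _ _).2 hμA
    simp [this]
  · by_cases hv0 : v = 0
    · rw [extDirMultipliersTilde, if_pos hv0, hlamS]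
      refine sum_smul_mem_of_convex (convex_convexHull ℝ _) h.nonneg h.sum_eq_one fun S hS => ?_
      have h1 := h.extremal S hS
      exact subset_convexHull ℝ _ (Set.mem_biUnion
        (show u S ∈ {u | u ∈ criticalCone q ybar ystar ∧ u ≠ 0} from
          ⟨(mem_criticalCone_iff hq hy hsub).2 h1.2.2.2.2.1, h1.2.2.2.2.2.1⟩) (hext S hS))
    · rw [extDirMultipliersTilde, if_neg hv0]
      have hu : ∀ S, α S ≠ 0 → u S = v := fun S hS =>
        (h.extremal S hS).2.2.2.2.2.2 hv0
      refine ⟨⟨hlam', fun lam' h' => ?_⟩, ?_⟩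
      · have hle : ∀ S, α S * inner ℝ v (hessLag q lam' ybar v) ≤
            α S * ∑ i, e S i * d2q q ybar i v v := by
          intro S
          by_cases hS : α S = 0
          · rw [hS, zero_mul, zero_mul]
          · refine mul_le_mul_of_nonneg_left ?_ (h.nonneg S)
            have h1 := (hext S hS).1.2 lam' h'
            rw [hu S hS, inner_hessLag hq (WithLp.toLp 2 (e S))] at h1
            exact h1
        have h2 := Finset.sum_le_sum fun S (_ : S ∈ Finset.univ) => hle S
        rw [← Finset.sum_mul, h.sum_eq_one, one_mul, hsum] at h2
        rwa [inner_hessLag hq lam]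
      · rw [hlamS]
        exact sum_smul_mem_of_convex (convex_convexHull ℝ _) h.nonneg h.sum_eq_one fun S hS =>
          (hext S hS).2
  · rintro i (hi | hi)
    · exact hlamIp i (ne_of_gt hi)
    · by_contra hcon
      exact hi.2.ne' (hμs.1 i hcon)
  · have := h.solves
    rw [← hJ] at this
    exact ⟨fun i hi => by simpa using this.1 i hi, fun i hi => by simpa using this.2 i hi⟩
  · have := h.solvesDir
    rw [← hJ] at this
    obtain ⟨z, hz⟩ := this
    exact ⟨z, hz.1, hz.2⟩
  · obtain ⟨μ', hμ', hμ'A⟩ := h.polar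
    rw [← hJ] at hμ'
    refine ⟨WithLp.toLp 2 μ', hμ', (dqT_eq_iff _ _ _).2 fun x => ?_⟩
    rw [inner_add_left, real_inner_comm x (hessLag q lam ybar p.snd), inner_hessLag hq lam,
      ← hsum fun i => d2q q ybar i x p.snd]
    exact hμ'A x

end Translation

end NormalConeMap

/-! ### Assembly: approximating sequences and the case distinction. -/

open NormalConeMap
theorem mainTheorem4 (m l : ℕ) (q : Eu m → Eu l) (hq : ContDiff ℝ 2 q)
    (ybar ystar vstar : Eu m)
    (hy : ybar ∈ feasibleSet q)
    (hystar : ystar ∈ regNormalCone (feasibleSet q) ybar)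
    (hvstar : vstar ≠ 0)
    (htan : pair 0 vstar ∈ tangentCone (gphNormal q) (pair ybar ystar))
    (hsub : MetricallySubregularAt (perturbMap q) ybar 0) :
    (criticalCone q ybar ystar ≠ {0} →
      normalConeTwo (gphNormal q) ybar ystar vstar ⊆
        ⋂ v ∈ nullSpace q ybar,
          {p | ∃ lam μ : Eu l, (lam, μ) ∈ multiplierPairs q ybar ystar 0 vstar ∧
            lam ∈ extDirMultipliersTilde q ybar ystar v ∧
            ∃ J ∈ dualActiveSets q ybar v, ∃ Ip I : Set (Fin l),
              posIdxPair lam μ ⊆ Ip ∧ Ip ⊆ I ∧ I ⊆ J ∧ p ∈ QZero q ybar v lam Ip I}) ∧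
    (criticalCone q ybar ystar = {0} →
      normalConeTwo (gphNormal q) ybar ystar vstar ⊆ {p | p.snd = 0}) := by
  suffices H : ∀ p ∈ normalConeTwo (gphNormal q) ybar ystar vstar,
      (criticalCone q ybar ystar ≠ {0} → ∀ v ∈ nullSpace q ybar,
          ∃ lam μ : Eu l, (lam, μ) ∈ multiplierPairs q ybar ystar 0 vstar ∧
            lam ∈ extDirMultipliersTilde q ybar ystar v ∧
            ∃ J ∈ dualActiveSets q ybar v, ∃ Ip I : Set (Fin l),
              posIdxPair lam μ ⊆ Ip ∧ Ip ⊆ I ∧ I ⊆ J ∧ p ∈ QZero q ybar v lam Ip I) ∧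
        (criticalCone q ybar ystar = {0} → p.snd = 0) from
    ⟨fun hK p hp => Set.mem_iInter₂.2 fun v hv => (H p hp).1 hK v hv,
      fun hK p hp => (H p hp).2 hK⟩
  rintro p ⟨t, vs, ws, ht, ht0, hvs, hws, hreg⟩
  let ysk : ℕ → Eu m := fun k => ystar + t k • vs k
  have hysk : Tendsto ysk atTop (𝓝 ystar) := by
    simpa using tendsto_const_nhds.add (ht0.smul hvs)
  have hfst : Tendsto (fun k => (ws k).fst) atTop (𝓝 p.fst) :=
    ((WithLp.prod_continuous_ofLp 2 (Eu m) (Eu m)).fst.tendsto p).comp hws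
  have hsnd : Tendsto (fun k => (ws k).snd) atTop (𝓝 p.snd) :=
    ((WithLp.prod_continuous_ofLp 2 (Eu m) (Eu m)).snd.tendsto p).comp hws
  have hne := multSet_nonempty_of_mem_regNormalCone hq hsub hystar
  have hnes : ∀ k, (MultSet (dqLin q ybar) (active q ybar) (innerLin (ysk k))).Nonempty := fun k =>
    multSet_nonempty_of_mem_regNormalCone hq hsub (hreg k).1
  have hw := fun k => snd_mem_critCone_of_mem_regNormalCone_gphNormal hq hsub (hreg k)
  have hdual : ∀ y : Eu m, ∀ v ∈ CritCone (dqLin q ybar) (active q ybar) (innerLin y),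
      ∃ z, ∀ i ∈ active q ybar, dqLin q ybar i z + d2qLin q ybar i v v ≤ 0 := fun y v hv =>
    exists_dual_feasible hq hy hsub hv.1
  have hylim : ∀ x, Tendsto (fun k => innerLin (ysk k) x) atTop (𝓝 (innerLin ystar x)) := fun x =>
    hysk.inner tendsto_const_nhds
  have hvlim : ∀ x, Tendsto (fun k => (t k)⁻¹ * (innerLin (ysk k) x - innerLin ystar x)) atTop
      (𝓝 (innerLin vstar x)) := fun x => by
    refine (hvs.inner (tendsto_const_nhds (x := x))).congr fun k => ?_
    simp only [ysk, innerLin_apply, inner_add_left, real_inner_smul_left, add_sub_cancel_left]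
    rw [inv_mul_cancel_left₀ (ht k).ne']
  refine ⟨fun hK v hv => ?_, fun hK => ?_⟩
  · obtain ⟨u₀, hu₀, hu₀0⟩ : ∃ u ∈ criticalCone q ybar ystar, u ≠ 0 := by
      by_contra hcon
      push Not at hcon
      refine hK (Set.Subset.antisymm hcon ?_)
      rintro _ rfl
      rw [mem_criticalCone_iff hq hy hsub]
      exact ⟨fun i _ => (map_zero (dqLin q ybar i)).le, by simp⟩
    -- The general construction needs, for infinitely many k, either v nonzero or a nonzero critical
    -- direction for `ysk k`; this isolates its only failure.
    by_cases hcase : v = 0 ∧ ∀ᶠ k in atTop,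
        ∀ u ∈ CritCone (dqLin q ybar) (active q ybar) (innerLin (ysk k)), u = 0
    · obtain ⟨rfl, htriv⟩ := hcase
      have hp0 : p.snd = 0 := tendsto_nhds_unique hsnd
        (tendsto_const_nhds.congr' (htriv.mono fun k hk => (hk _ (hw k)).symm))
      have hu₀' := (mem_criticalCone_iff hq hy hsub).1 hu₀
      obtain ⟨Ip, z₀, α, e, u, hP, hμ⟩ := exists_polarData_of_critCone_trivial
        (B := d2qLin q ybar) (ws := innerLin p.fst) ht hvlim hne hnes hu₀' hu₀0
        (hdual ystar u₀ hu₀') htriv.frequently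
      refine exists_QZero_of_polarData hq hy hsub hv (p := p) (z₀ := z₀) (u := u) ?_ hμ
      rw [hp0]
      exact hP
    · have hfr : ∃ᶠ k in atTop, ∃ u ∈ CritCone (dqLin q ybar) (active q ybar) (innerLin (ysk k)),
          v ≠ 0 ∨ u ≠ 0 := by
        by_cases hv0 : v = 0
        · refine (not_eventually.1 fun h => hcase ⟨hv0, h⟩).mono fun k hk => ?_
          push Not at hk
          obtain ⟨u, hu, hu0⟩ := hk
          exact ⟨u, hu, Or.inr hu0⟩
        · exact Frequently.of_forall fun k => ⟨_, hw k, Or.inl hv0⟩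
      obtain ⟨Ip, z₀, α, e, u, hP, hμ⟩ := exists_polarData_of_tendsto
        (continuous_d2qLin (q := q) ybar) ht hylim hvlim
        (wss := fun k => innerLin (ws k).fst) (ws := innerLin p.fst)
        (fun x => hfst.inner tendsto_const_nhds) hsnd
        (hfr.mono fun k hk => exists_polarData (hnes k) (hw k)
          (polar_of_mem_regNormalCone_gphNormal hq hsub (hreg k)) (hdual (ysk k)) hv hk)
      exact exists_QZero_of_polarData hq hy hsub hv hP hμ
  -- The second components are critical for `ysk k`, and both the inequalities and the orthogonality
  -- pass to the limit.
  · have : p.snd ∈ criticalCone q ybar ystar := by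
      rw [mem_criticalCone_iff hq hy hsub]
      refine ⟨fun i hi => ?_, ?_⟩
      · exact le_of_tendsto' (((dqLin q ybar i).continuous_of_finiteDimensional.tendsto _).comp
          hsnd) fun k => (hw k).1 i hi
      · have h1 := hysk.inner hsnd (𝕜 := ℝ)
        have h2 : ∀ k, inner ℝ (ysk k) (ws k).snd = 0 := fun k => (hw k).2
        simp only [h2] at h1
        exact tendsto_nhds_unique h1 tendsto_const_nhds
    rw [hK] at this
    exact this
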